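/- **Proposition (correctability bound for toric codes).** For every integer $i \ge 1$ there is a constant $C > 0$, depending only on $i$, such that the following holds for every dimension $D \ge i+1$, every integer $L \ge 1$ and the toric code $\mathrm{TC}(D,i)$ on the torus $\mathbb{R}^D/(L\mathbb{Z})^D$ tiled by $L^D$ unit cubes: the Union-Find decoder successfully corrects every $X$ error $x$ of weight $|x| \le C\,L^{i/2}$. *The code.* Qubits are the $i$-cells; each $(i-1)$-cell gives a $Z$ check acting on the $i$-cells whose boundary contains it; each $(i+1)$-cell gives an $X$ stabilizer supported on its boundary. An $X$ error is a set $x$ of $i$-cells (an $i$-chain mod 2), its weight $|x|$ is its number of cells, its syndrome $\sigma(x)$ is the set of $(i-1)$-cells in its boundary $\partial x$ mod 2, and it is a stabilizer if it is the boundary mod 2 of an $(i+1)$-chain. The Tanner graph $T$ is the bipartite graph on qubits and $Z$ checks in which a qubit and a check are adjacent iff the check acts on the qubit. *The decoder.* For a set $\mathcal{E}$ of vertices of $T$, let $\mathrm{Int}(\mathcal{E})$ be the set of vertices of $\mathcal{E}$ all of whose neighbors lie in $\mathcal{E}$. A valid correction in $\mathcal{E}$ for the syndrome $\sigma$ is a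 set of qubits $\tilde x \subseteq \mathrm{Int}(\mathcal{E})$ with $\sigma(\tilde x) = \sigma \cap \mathcal{E}$, and $\mathcal{E}$ is valid if one exists. On input $\sigma = \sigma(x)$ the decoder starts with $\mathcal{E} = \sigma$; while some connected component of $\mathcal{E}$ is invalid, it adds to $\mathcal{E}$ all neighbors of $\mathcal{E}$. It then chooses an arbitrary valid correction $\tilde x_j$ in each connected component $\mathcal{E}_j$ of $\mathcal{E}$ and returns $\tilde x = \bigcup_j \tilde x_j$. *Success.* The decoder successfully corrects $x$ if it terminates with an output and, for every choice of the valid corrections, the residual error $x + \tilde x$ (sum mod 2, i.e. symmetric difference) is a stabilizer. -/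

import Mathlib

open scoped Matrix symmDiff

/-! ### Graphs -/

/-- The ball `B_G(A, 1)`: the vertices of `A` together with all their neighbors. -/
def ballOne {V : Type*} (G : SimpleGraph V) (A : Set V) : Set V :=
  {v | v ∈ A ∨ ∃ u ∈ A, G.Adj u v}

/-- The interior of `A`: the vertices of `A` all of whose neighbors belong to `A`. -/
def graphInterior {V : Type*} (G : SimpleGraph V) (A : Set V) : Set V :=
  {u | u ∈ A ∧ ∀ v, G.Adj u v → v ∈ A}

/-- The connected components of the vertex set `A` (connectivity through paths inside `A`). -/
abbrev SetComponent {V : Type*} (G : SimpleGraph V) (A : Set V) : Type _ :=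
  (G.induce A).ConnectedComponent

/-- The set of vertices of a connected component of `A`. -/
def SetComponent.verts {V : Type*} {G : SimpleGraph V} {A : Set V}
    (K : SetComponent G A) : Set V :=
  Subtype.val '' (SimpleGraph.ConnectedComponent.supp K)

/-! ### CSS codes -/

/-- A CSS code: a pair of binary parity-check matrices with `H_X H_Zᵀ = 0`.
The columns (qubits) are indexed by `Q`. -/
structure CSSCode (RX RZ Q : Type*) [Fintype Q] where
  HX : Matrix RX Q (ZMod 2)
  HZ : Matrix RZ Q (ZMod 2)
  orthogonal : HX * HZᵀ = 0

namespace CSSCode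

/-- The binary vector of an `X` error given by its support. -/
def errorVec {Q : Type*} [DecidableEq Q] (x : Finset Q) : Q → ZMod 2 :=
  fun q => if q ∈ x then 1 else 0

/-- The syndrome of an `X` error, as the set of `Z` checks with a nontrivial outcome. -/
def syndrome {RX RZ Q : Type*} [Fintype Q] [DecidableEq Q]
    (S : CSSCode RX RZ Q) (x : Finset Q) : Set RZ :=
  {c | (S.HZ *ᵥ errorVec x) c ≠ 0}

/-- An `X` error is a stabilizer if its vector lies in the row space of `H_X`. -/
def IsStabilizer {RX RZ Q : Type*} [Fintype Q] [DecidableEq Q]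
    (S : CSSCode RX RZ Q) (x : Finset Q) : Prop :=
  errorVec x ∈ Submodule.span (ZMod 2) (Set.range S.HX.row)

/-- The Tanner graph of the `Z` checks: `q` and `c` are joined iff the check `c` acts
nontrivially on the qubit `q`. -/
def tannerGraph {RX RZ Q : Type*} [Fintype Q] (S : CSSCode RX RZ Q) : SimpleGraph (Q ⊕ RZ) where
  Adj u v := (∃ q c, u = Sum.inl q ∧ v = Sum.inr c ∧ S.HZ c q ≠ 0) ∨
    (∃ q c, u = Sum.inr c ∧ v = Sum.inl q ∧ S.HZ c q ≠ 0)
  symm := ⟨by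
    rintro u v (⟨q, c, hu, hv, h⟩ | ⟨q, c, hu, hv, h⟩)
    · exact Or.inr ⟨q, c, hv, hu, h⟩
    · exact Or.inl ⟨q, c, hv, hu, h⟩⟩
  loopless := ⟨by
    rintro u (⟨q, c, hu, hv, -⟩ | ⟨q, c, hu, hv, -⟩) <;> simp [hu] at hv⟩

/-! ### The Union-Find decoder -/

/-- `x` is a valid correction in the set `E` of nodes of the Tanner graph for the syndrome `σ`:
`x ⊆ Int(E)` and `σ(x) = σ ∩ E`. -/
def IsValidCorrection {RX RZ Q : Type*} [Fintype Q] [DecidableEq Q]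
    (S : CSSCode RX RZ Q) (σ : Set RZ) (E : Set (Q ⊕ RZ)) (x : Finset Q) : Prop :=
  (∀ q ∈ x, Sum.inl q ∈ graphInterior S.tannerGraph E) ∧
    S.syndrome x = {c | c ∈ σ ∧ Sum.inr c ∈ E}

/-- The set `E` is valid for the syndrome `σ`. -/
def IsValid {RX RZ Q : Type*} [Fintype Q] [DecidableEq Q]
    (S : CSSCode RX RZ Q) (σ : Set RZ) (E : Set (Q ⊕ RZ)) : Prop :=
  ∃ x : Finset Q, S.IsValidCorrection σ E x

/-- All connected components of `E` are valid for the syndrome `σ`. -/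
def AllComponentsValid {RX RZ Q : Type*} [Fintype Q] [DecidableEq Q]
    (S : CSSCode RX RZ Q) (σ : Set RZ) (E : Set (Q ⊕ RZ)) : Prop :=
  ∀ K : SetComponent S.tannerGraph E, S.IsValid σ K.verts

/-- `GrowthLoop σ E F`: the loop "while `E` has an invalid connected component, replace `E`
by `B_T(E, 1)`", started at `E`, stops after finitely many rounds with the set `F`. -/
inductive GrowthLoop {RX RZ Q : Type*} [Fintype Q] [DecidableEq Q]
    (S : CSSCode RX RZ Q) (σ : Set RZ) : Set (Q ⊕ RZ) → Set (Q ⊕ RZ) → Prop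
  | halt (E : Set (Q ⊕ RZ)) (h : S.AllComponentsValid σ E) : GrowthLoop S σ E E
  | grow (E F : Set (Q ⊕ RZ)) (h : ¬ S.AllComponentsValid σ E)
      (hF : GrowthLoop S σ (ballOne S.tannerGraph E) F) : GrowthLoop S σ E F

/-- `y` is a possible output of the Union-Find decoder on the syndrome `σ`: the growth loop
started at `σ` stops with some set `E`, and `y` is the union of valid corrections, one chosen
(arbitrarily) for each connected component of `E`. -/
def IsUnionFindOutput {RX RZ Q : Type*} [Fintype Q] [DecidableEq Q]
    (S : CSSCode RX RZ Q) (σ : Set RZ) (y : Finset Q) : Prop :=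
  ∃ E : Set (Q ⊕ RZ), S.GrowthLoop σ (Sum.inr '' σ) E ∧
    ∃ z : SetComponent S.tannerGraph E → Finset Q,
      (∀ K, S.IsValidCorrection σ K.verts (z K)) ∧ ∀ q, q ∈ y ↔ ∃ K, q ∈ z K

/-- The Union-Find decoder successfully corrects the `X` error `x`: it terminates with an output
on the syndrome of `x`, and whatever valid corrections it chooses, the residual error (the sum
mod 2 of `x` and of the output) is a stabilizer. -/
def UnionFindCorrects {RX RZ Q : Type*} [Fintype Q] [DecidableEq Q]
    (S : CSSCode RX RZ Q) (x : Finset Q) : Prop :=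
  (∃ y, S.IsUnionFindOutput (S.syndrome x) y) ∧
    ∀ y, S.IsUnionFindOutput (S.syndrome x) y → S.IsStabilizer (x ∆ y)

end CSSCode

/-! ### Toric codes -/

/-- The `k`-cells of the torus `ℝ^D / (Lℤ)^D` tiled by unit cubes: the pair `(p, I)` with `|I| = k`
is the cell `{p + ∑_{j ∈ I} t_j e_j | t_j ∈ [0, 1]}`. -/
abbrev TorusCell (D L k : ℕ) : Type :=
  {c : (Fin D → ZMod L) × Finset (Fin D) // c.2.card = k}

/-- The two opposite faces of the cell `(p, I)` orthogonal to the direction `j`: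
`(p, I \ {j})` for `s = 0` and `(p + e_j, I \ {j})` for `s = 1`. -/
def torusFace {D L : ℕ} (c : (Fin D → ZMod L) × Finset (Fin D)) (j : Fin D) (s : Fin 2) :
    (Fin D → ZMod L) × Finset (Fin D) :=
  (c.1 + (if s = 1 then Pi.single j 1 else 0), c.2.erase j)

/-- The matrix of the `ℤ/2` cellular boundary map from `l`-chains to `k`-chains, where `l = k + 1`:
the column of a cell `c` is the sum of the faces of `c`. -/
def torusBoundary (D L k l : ℕ) : Matrix (TorusCell D L k) (TorusCell D L l) (ZMod 2) :=
  fun f c => ∑ j ∈ c.1.2, ∑ s : Fin 2, if f.1 = torusFace c.1 j s then 1 else 0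

theorem torusFace_comm {D L : ℕ} (c : (Fin D → ZMod L) × Finset (Fin D)) (j j' : Fin D)
    (s s' : Fin 2) :
    torusFace (torusFace c j s) j' s' = torusFace (torusFace c j' s') j s := by
  simp only [torusFace, Prod.mk.injEq]
  exact ⟨add_right_comm _ _ _, Finset.erase_right_comm⟩

theorem sum_erase_symm_eq_zero {α : Type*} [DecidableEq α] (A : Finset α) (H : α → α → ZMod 2)
    (hH : ∀ a b, H a b = H b a) : ∑ a ∈ A, ∑ b ∈ A.erase a, H a b = 0 := by
  rw [Finset.sum_sigma']
  refine Finset.sum_involution (fun p _ => ⟨p.2, p.1⟩) ?_ ?_ ?_ ?_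
  · rintro ⟨a, b⟩ -
    simp only [hH b a]
    exact CharTwo.add_self_eq_zero _
  · rintro ⟨a, b⟩ h - h'
    simp only [Finset.mem_sigma, Finset.mem_erase] at h
    exact h.2.1 (congrArg Sigma.fst h')
  · rintro ⟨a, b⟩ h
    simp only [Finset.mem_sigma, Finset.mem_erase] at h ⊢
    exact ⟨h.2.2, Ne.symm h.2.1, h.1⟩
  · rintro ⟨a, b⟩ -
    rfl

/-- The boundary of a boundary is zero. -/
theorem torusBoundary_mul (D L : ℕ) [NeZero L] (k l m : ℕ) (hl : l + 1 = m) :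
    torusBoundary D L k l * torusBoundary D L l m = 0 := by
  ext f g
  have key : ∀ F : (Fin D → ZMod L) × Finset (Fin D) → ZMod 2, ∀ j ∈ g.1.2, ∀ s : Fin 2,
      ∑ c : TorusCell D L l, F c.1 * (if c.1 = torusFace g.1 j s then 1 else 0)
        = F (torusFace g.1 j s) := by
    intro F j hj s
    have hc : (torusFace g.1 j s).2.card = l := by
      have := g.2
      simp only [torusFace, Finset.card_erase_of_mem hj]
      omega
    rw [Finset.sum_eq_single (⟨torusFace g.1 j s, hc⟩ : TorusCell D L l)]
    · simp
    · intro b _ hb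
      rw [if_neg (fun h => hb (Subtype.ext h)), mul_zero]
    · intro h
      exact absurd (Finset.mem_univ _) h
  rw [Matrix.mul_apply, Matrix.zero_apply]
  simp only [torusBoundary]
  have : ∀ c : TorusCell D L l,
      (∑ j ∈ c.1.2, ∑ s : Fin 2, if f.1 = torusFace c.1 j s then (1 : ZMod 2) else 0) *
        (∑ j ∈ g.1.2, ∑ s : Fin 2, if c.1 = torusFace g.1 j s then (1 : ZMod 2) else 0) =
      ∑ j ∈ g.1.2, ∑ s : Fin 2,
        (∑ j ∈ c.1.2, ∑ s : Fin 2, if f.1 = torusFace c.1 j s then (1 : ZMod 2) else 0) *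
          (if c.1 = torusFace g.1 j s then (1 : ZMod 2) else 0) := by
    intro c
    rw [Finset.mul_sum]
    exact Finset.sum_congr rfl fun j _ => Finset.mul_sum _ _ _
  rw [Finset.sum_congr rfl fun c _ => this c, Finset.sum_comm]
  have step : ∀ j ∈ g.1.2,
      (∑ c : TorusCell D L l, ∑ s : Fin 2,
        (∑ j ∈ c.1.2, ∑ s : Fin 2, if f.1 = torusFace c.1 j s then (1 : ZMod 2) else 0) *
          (if c.1 = torusFace g.1 j s then (1 : ZMod 2) else 0)) =
      ∑ j' ∈ g.1.2.erase j, ∑ s : Fin 2, ∑ s' : Fin 2,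
        if f.1 = torusFace (torusFace g.1 j s) j' s' then (1 : ZMod 2) else 0 := by
    intro j hj
    rw [Finset.sum_comm, Finset.sum_comm (s := g.1.2.erase j)]
    refine Finset.sum_congr rfl fun s _ => ?_
    exact key (fun c => ∑ j ∈ c.2, ∑ s : Fin 2,
      if f.1 = torusFace c j s then (1 : ZMod 2) else 0) j hj s
  rw [Finset.sum_congr rfl step]
  refine sum_erase_symm_eq_zero g.1.2 (fun j j' => ∑ s : Fin 2, ∑ s' : Fin 2,
    if f.1 = torusFace (torusFace g.1 j s) j' s' then (1 : ZMod 2) else 0) ?_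
  intro a b
  rw [Finset.sum_comm]
  refine Finset.sum_congr rfl fun s _ => Finset.sum_congr rfl fun s' _ => ?_
  rw [torusFace_comm]

/-- The toric code `TC(D, i)` on the torus `ℝ^D / (Lℤ)^D`: qubits on the `i`-cells, `X` stabilizers
on the `(i+1)`-cells (the boundary of the cell), `Z` checks on the `(i-1)`-cells (the `i`-cells
whose boundary contains the cell). -/
def toricCode (D L i : ℕ) [NeZero L] :
    CSSCode (TorusCell D L (i + 1)) (TorusCell D L (i - 1)) (TorusCell D L i) where
  HX := (torusBoundary D L i (i + 1))ᵀ
  HZ := torusBoundary D L (i - 1) i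
  orthogonal := by
    rw [← Matrix.transpose_mul, torusBoundary_mul D L (i - 1) i (i + 1) rfl, Matrix.transpose_zero]

/-! Put i = k + 1 and n = |x|. The exponent i/2 comes from a count: O(n) checks, each surrounded by
a ball of radius O(n^(1/i)), project onto O(n²) cells of an i-dimensional coordinate subtorus, which
has L^i cells.

Locality. Let x' have least mass among the i-chains with the boundary of x. If a cell of x' is
farther than 2R from that boundary, minimality forces the mass of x' around the cell to grow like
R^i, so R = O(n^(1/i)) (`exists_monotonicity`, `exists_filling_near_bdry`). A ball of the torus is
absorbed by a Tanner ball of proportional radius (`mem_graphInterior_of_torusDist_le`). Hence for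
nonempty x some t = O(n^(1/i)) has the property that all components are valid after t rounds, and
the decoder has stopped by then (`CSSCode.unionFindCorrects_of_ball`).

Topology. The residual error is a cycle inside x together with the t-ball about at most 2in checks.
By the count it misses a cell of every coordinate i-subtorus (`exists_missed_cell`). The mod 2
homology of the torus is detected by degrees over these subtori, and a degree can be read off at a
missed cell, so the cycle is a boundary (`exists_bdry_eq_of_missed`).

Constants independent of D. Monotonicity rests on an isoperimetric inequality for k-cycles of small
mass, proved by induction on k in the manner of Gromov and Wenger. A mass bound in dimension k gives
monotonicity for minimal fillings, which keeps those fillings near their boundary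
(`FillingMassBound.fillingBound`). Such fillings close up thin slices of a (k+1)-cycle by spheres,
cutting it into cycles that lie in small balls and can be coned off
(`FillingBound.fillingMassBound_succ`). The cone inequality `exists_cone` is free of D because it
uses the ℓ¹ metric. -/

/-! ### The circle `ℤ / L` -/

/-- The signed position of `v` relative to `p` on the circle `ℤ / L`. -/
def circlePos {L : ℕ} (p v : ZMod L) : ℤ := (v - p).valMinAbs

/-- The base point of the edge of the circle opposite to `p`. -/
def antipode {L : ℕ} (p : ZMod L) : ZMod L := p + ((L / 2 : ℕ) : ZMod L)

/-- The coefficient of the edge `[t, t + 1]` in the path from `p` to `v` that avoids the edge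
opposite to `p`. -/
def arcCoeff {L : ℕ} (p t v : ZMod L) : ZMod 2 :=
  (if circlePos p t < circlePos p v then 1 else 0) + (if circlePos p t < 0 then 1 else 0)

section Circle

variable {L : ℕ} [NeZero L]

theorem circlePos_eq_iff (p v : ZMod L) (y : ℤ) :
    circlePos p v = y ↔ v - p = (y : ZMod L) ∧ y * 2 ∈ Set.Ioc (-(L : ℤ)) L :=
  ZMod.valMinAbs_spec _ _

theorem circlePos_bounds (p v : ZMod L) : -(L : ℤ) < circlePos p v * 2 ∧ circlePos p v * 2 ≤ L :=
  ((circlePos_eq_iff p v _).1 rfl).2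

theorem circlePos_inj {p v w : ZMod L} : circlePos p v = circlePos p w ↔ v = w := by
  refine ⟨fun h => ?_, fun h => h ▸ rfl⟩
  have h1 := ((circlePos_eq_iff p v _).1 h).1
  have h2 := ((circlePos_eq_iff p w _).1 rfl).1
  rw [← h2] at h1
  exact sub_left_injective h1

omit [NeZero L] in
@[simp] theorem circlePos_self (p : ZMod L) : circlePos p p = 0 := by simp [circlePos]

theorem circlePos_antipode (p : ZMod L) : circlePos p (antipode p) = ((L / 2 : ℕ) : ℤ) := by
  rw [circlePos_eq_iff]
  refine ⟨by rw [antipode, Int.cast_natCast, add_sub_cancel_left], ?_⟩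
  have : 0 < L := Nat.pos_of_ne_zero (NeZero.ne L)
  constructor <;> omega

/-- The position jumps only across the edge opposite to `p`; this jump is the source of the homology
of the circle. -/
theorem circlePos_add_one {p v : ZMod L} (h : v ≠ antipode p) :
    circlePos p (v + 1) = circlePos p v + 1 := by
  have h1 := circlePos_bounds p v
  have h2 : circlePos p v ≠ ((L / 2 : ℕ) : ℤ) := by
    rw [← circlePos_antipode p]
    exact fun h' => h (circlePos_inj.1 h')
  rw [circlePos_eq_iff]
  refine ⟨?_, by constructor <;> omega⟩
  push_cast
  rw [← ((circlePos_eq_iff p v _).1 rfl).1]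
  ring

theorem circlePos_antipode_add_one (p : ZMod L) :
    circlePos p (antipode p + 1) = ((L / 2 : ℕ) : ℤ) + 1 - L := by
  have : 0 < L := Nat.pos_of_ne_zero (NeZero.ne L)
  rw [circlePos_eq_iff]
  refine ⟨?_, by constructor <;> omega⟩
  rw [antipode, Int.cast_sub, Int.cast_add, Int.cast_natCast, Int.cast_natCast, ZMod.natCast_self]
  push_cast
  ring

theorem arcCoeff_add_arcCoeff_sub_one (p t v : ZMod L) :
    arcCoeff p t v + arcCoeff p (t - 1) v = (if t = v then 1 else 0) + (if t = p then 1 else 0) := by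
  -- Each summand of `arcCoeff` is a path starting at `antipode p + 1`, one ending at `v` and the
  -- other at `p`. The common starting point cancels mod 2.
  have key : ∀ v : ZMod L, ((if circlePos p t < circlePos p v then 1 else 0) +
      (if circlePos p (t - 1) < circlePos p v then 1 else 0) : ZMod 2) =
      (if t = v then 1 else 0) + (if t - 1 = antipode p then 1 else 0) := by
    intro v
    have hv := circlePos_bounds p v
    have hinj : t = v ↔ circlePos p t = circlePos p v := circlePos_inj.symm
    simp only [hinj]
    by_cases h : t - 1 = antipode p
    · have h1 := circlePos_antipode p
      have h2 := circlePos_antipode_add_one p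
      rw [← h, sub_add_cancel] at h2
      rw [← h] at h1
      split_ifs <;> first | rfl | (exfalso; omega)
    · have h1 := circlePos_add_one h
      rw [sub_add_cancel] at h1
      split_ifs <;> first | rfl | (exfalso; omega)
  have h1 := key v
  have h2 := key p
  rw [circlePos_self] at h2
  simp only [arcCoeff]
  rw [add_add_add_comm, h1, h2, add_add_add_comm, CharTwo.add_self_eq_zero, add_zero]

/-- Moving the endpoint across an ordinary edge changes the path by that edge. Across the opposite
edge the path switches sides, and the two paths together make up every edge except the opposite one.
-/
theorem arcCoeff_add_arcCoeff_add_one (p t v : ZMod L) :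
    arcCoeff p t v + arcCoeff p t (v + 1) =
      (if v = t then 1 else 0) + (if v = antipode p then 1 else 0) := by
  simp only [arcCoeff]
  rw [add_add_add_comm, CharTwo.add_self_eq_zero, add_zero]
  have hv := circlePos_bounds p t
  have hinj : v = t ↔ circlePos p v = circlePos p t := circlePos_inj.symm
  simp only [hinj]
  by_cases h : v = antipode p
  · have h1 := circlePos_antipode p
    have h2 := circlePos_antipode_add_one p
    rw [← h] at h1 h2
    split_ifs <;> first | rfl | (exfalso; omega)
  · have h1 := circlePos_add_one h
    split_ifs <;> first | rfl | (exfalso; omega)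

omit [NeZero L] in
theorem arcCoeff_ne_zero {p t v : ZMod L} (h : arcCoeff p t v ≠ 0) :
    circlePos p t ∈ Finset.Ico (min 0 (circlePos p v)) (max 0 (circlePos p v)) := by
  rw [Finset.mem_Ico]
  simp only [arcCoeff] at h
  split_ifs at h
  · exact absurd (by decide) h
  · omega
  · omega
  · simp at h

omit [NeZero L] in
theorem natAbs_circlePos_le_of_arcCoeff_ne_zero {p t v : ZMod L} (h : arcCoeff p t v ≠ 0) :
    (circlePos p t).natAbs ≤ (circlePos p v).natAbs := by
  have := Finset.mem_Ico.1 (arcCoeff_ne_zero h)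
  omega

theorem card_arcCoeff_ne_zero_le (p v : ZMod L) :
    (Finset.univ.filter fun t => arcCoeff p t v ≠ 0).card ≤ (circlePos p v).natAbs := by
  have := Finset.card_le_card_of_injOn (t := Finset.Ico (min 0 (circlePos p v))
    (max 0 (circlePos p v))) (circlePos p) (s := Finset.univ.filter fun t => arcCoeff p t v ≠ 0)
    (fun t ht => arcCoeff_ne_zero (by simpa using ht))
    (fun a _ b _ hab => circlePos_inj.1 hab)
  rw [Int.card_Ico] at this
  omega

end Circle

/-! ### Chains of the torus -/

/-- The cells, of all dimensions, of the torus. -/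
abbrev CubeCell (D L : ℕ) : Type := (Fin D → ZMod L) × Finset (Fin D)

/-- The chains mod 2, of all dimensions, of the torus. -/
abbrev CubeChain (D L : ℕ) : Type := CubeCell D L → ZMod 2

/-- The part of the boundary map that consists of the faces orthogonal to the direction `l`. -/
def bdryDir {D L : ℕ} (l : Fin D) : CubeChain D L →+ CubeChain D L where
  toFun z c := if l ∈ c.2 then 0 else
    z (c.1, insert l c.2) + z (c.1 - Pi.single l 1, insert l c.2)
  map_zero' := by ext c; simp
  map_add' z w := by
    ext c
    simp only [Pi.add_apply]
    split_ifs
    · simp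
    · ring

/-- The boundary map. -/
def bdry {D L : ℕ} : CubeChain D L →+ CubeChain D L := ∑ l, bdryDir l

/-- The cells swept when the coordinate `j` is contracted to `p j`. -/
def coneDir {D L : ℕ} [NeZero L] (p : Fin D → ZMod L) (j : Fin D) :
    CubeChain D L →+ CubeChain D L where
  toFun z c := if j ∈ c.2 then
    ∑ v, arcCoeff (p j) (c.1 j) v * z (Function.update c.1 j v, c.2.erase j) else 0
  map_zero' := by ext c; simp
  map_add' z w := by
    ext c
    simp only [Pi.add_apply, mul_add, Finset.sum_add_distrib]
    split_ifs <;> simp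

/-- The chain map that contracts the coordinate `j` to `p j`, up to the edge opposite to `p j`
which it stretches over the whole circle. -/
def collapse {D L : ℕ} [NeZero L] (p : Fin D → ZMod L) (j : Fin D) (z : CubeChain D L) :
    CubeChain D L :=
  fun c => if j ∈ c.2 then z (Function.update c.1 j (antipode (p j)), c.2) else
    if c.1 j = p j then ∑ v, z (Function.update c.1 j v, c.2) else 0

section Chains

variable {D L : ℕ}

theorem bdryDir_apply (l : Fin D) (z : CubeChain D L) (c : CubeCell D L) :
    bdryDir l z c = if l ∈ c.2 then 0 else
      z (c.1, insert l c.2) + z (c.1 - Pi.single l 1, insert l c.2) := rfl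

theorem bdry_apply (z : CubeChain D L) : bdry z = ∑ l, bdryDir l z := by
  simp [bdry]

theorem bdry_apply_apply (z : CubeChain D L) (c : CubeCell D L) :
    bdry z c = ∑ l, bdryDir l z c := by
  simp [bdry]

theorem bdryDir_comm (l l' : Fin D) (z : CubeChain D L) :
    bdryDir l (bdryDir l' z) = bdryDir l' (bdryDir l z) := by
  by_cases h : l = l'
  · rw [h]
  ext c
  simp only [bdryDir_apply, Finset.mem_insert, h, Ne.symm h, false_or]
  rw [Finset.insert_comm, sub_right_comm]
  split_ifs <;> ring

theorem bdryDir_bdryDir_self (l : Fin D) (z : CubeChain D L) : bdryDir l (bdryDir l z) = 0 := by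
  ext c
  simp [bdryDir_apply]

/-- The directional boundaries commute and square to zero, so the double sum cancels in pairs mod 2.
-/
theorem bdry_bdry (z : CubeChain D L) : bdry (bdry z) = 0 := by
  ext c
  have h := sum_erase_symm_eq_zero (Finset.univ : Finset (Fin D))
    (fun l l' => bdryDir l (bdryDir l' z) c) (fun l l' => by rw [bdryDir_comm])
  rw [bdry_apply_apply, Pi.zero_apply, ← h]
  refine Finset.sum_congr rfl fun l _ => ?_
  rw [bdry_apply, map_sum, Finset.sum_apply, ← Finset.add_sum_erase _ _ (Finset.mem_univ l),
    bdryDir_bdryDir_self, Pi.zero_apply, zero_add]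

variable [NeZero L]

theorem coneDir_apply (p : Fin D → ZMod L) (j : Fin D) (z : CubeChain D L) (c : CubeCell D L) :
    coneDir p j z c = if j ∈ c.2 then
      ∑ v, arcCoeff (p j) (c.1 j) v * z (Function.update c.1 j v, c.2.erase j) else 0 := rfl

omit [NeZero L] in
theorem update_sub_single {l j : Fin D} (h : l ≠ j) (q : Fin D → ZMod L) (v : ZMod L) :
    Function.update (q - Pi.single l 1) j v = Function.update q j v - Pi.single l 1 := by
  ext m
  by_cases hm : m = j
  · subst hm
    simp [h]
  · simp [hm]

theorem bdryDir_coneDir (p : Fin D → ZMod L) {l j : Fin D} (h : l ≠ j) (z : CubeChain D L) :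
    bdryDir l (coneDir p j z) = coneDir p j (bdryDir l z) := by
  ext c
  simp only [bdryDir_apply, coneDir_apply, Finset.mem_insert, Ne.symm h, false_or,
    Finset.mem_erase, ne_eq, h, not_false_eq_true, true_and, update_sub_single h,
    Finset.erase_insert_of_ne h]
  have : (c.1 - Pi.single l 1 : Fin D → ZMod L) j = c.1 j := by simp [Ne.symm h]
  simp only [this]
  by_cases h1 : l ∈ c.2 <;> by_cases h2 : j ∈ c.2 <;>
    simp [h1, h2, mul_add, Finset.sum_add_distrib]

/-- The homotopy formula of a single circle factor. Cells along `j` use the variation of a path with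
its endpoint, cells orthogonal to `j` use the boundary of a path. -/
theorem bdryDir_coneDir_self (p : Fin D → ZMod L) (j : Fin D) (z : CubeChain D L) :
    bdryDir j (coneDir p j z) + coneDir p j (bdryDir j z) = z + collapse p j z := by
  ext c
  obtain ⟨q, I⟩ := c
  simp only [Pi.add_apply, bdryDir_apply, coneDir_apply, collapse]
  by_cases h : j ∈ I
  · simp only [h, if_true, zero_add, Finset.notMem_erase, if_false, Finset.insert_erase h]
    have e1 : ∀ v : ZMod L, Function.update q j v - Pi.single j 1 = Function.update q j (v - 1) := by
      intro v
      ext m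
      by_cases hm : m = j
      · subst hm; simp
      · simp [hm]
    simp only [e1, mul_add, Finset.sum_add_distrib]
    have e2 : ∑ v, arcCoeff (p j) (q j) v * z (Function.update q j (v - 1), I) =
        ∑ v, arcCoeff (p j) (q j) (v + 1) * z (Function.update q j v, I) := by
      refine Fintype.sum_equiv (Equiv.subRight (1 : ZMod L)) _ _ fun v => ?_
      simp
    rw [e2, ← Finset.sum_add_distrib]
    simp only [← add_mul, arcCoeff_add_arcCoeff_add_one]
    simp [add_mul, Finset.sum_add_distrib]
  · simp only [h, if_false, Finset.mem_insert_self, if_true, add_zero, Finset.erase_insert h]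
    have e1 : ∀ v : ZMod L, Function.update (q - Pi.single j 1) j v = Function.update q j v := by
      intro v
      ext m
      by_cases hm : m = j
      · subst hm; simp
      · simp [hm]
    simp only [e1, Pi.sub_apply, Pi.single_eq_same]
    rw [← Finset.sum_add_distrib]
    simp only [← add_mul, arcCoeff_add_arcCoeff_sub_one]
    simp only [add_mul, Finset.sum_add_distrib]
    congr 1
    · simp
    · split_ifs <;> simp

/-- A chain homotopy from the identity to `collapse p j`: the directions other than `j` commute with
the cone, so their contributions occur twice. -/
theorem bdry_coneDir (p : Fin D → ZMod L) (j : Fin D) (z : CubeChain D L) :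
    bdry (coneDir p j z) + coneDir p j (bdry z) = z + collapse p j z := by
  rw [bdry_apply, bdry_apply, map_sum, ← Finset.sum_add_distrib,
    ← Finset.add_sum_erase _ _ (Finset.mem_univ j), bdryDir_coneDir_self, add_eq_left]
  refine Finset.sum_eq_zero fun l hl => ?_
  rw [bdryDir_coneDir p (Finset.ne_of_mem_erase hl), CharTwo.add_self_eq_zero]

end Chains

/-! ### Supports, masses and distances -/

/-- The `ℓ¹` distance of two vertices of the torus. -/
def torusDist {D L : ℕ} (p q : Fin D → ZMod L) : ℕ := ∑ j, (circlePos (p j) (q j)).natAbs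

/-- The set of cells of a chain. -/
def chainSupp {D L : ℕ} [NeZero L] (z : CubeChain D L) : Finset (CubeCell D L) :=
  Finset.univ.filter fun c => z c ≠ 0

/-- The number of cells of a chain. -/
def chainMass {D L : ℕ} [NeZero L] (z : CubeChain D L) : ℕ := (chainSupp z).card

/-- A chain all of whose cells have dimension `k`. -/
def IsPure {D L : ℕ} (k : ℕ) (z : CubeChain D L) : Prop := ∀ c, z c ≠ 0 → c.2.card = k

section Support

variable {D L : ℕ}

theorem torusDist_self (p : Fin D → ZMod L) : torusDist p p = 0 := by
  simp [torusDist]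

theorem torusDist_comm (p q : Fin D → ZMod L) : torusDist p q = torusDist q p := by
  refine Finset.sum_congr rfl fun j _ => ?_
  rw [circlePos, circlePos, ← ZMod.natAbs_valMinAbs_neg, neg_sub]

theorem natAbs_circlePos_le_torusDist (p q : Fin D → ZMod L) (j : Fin D) :
    (circlePos (p j) (q j)).natAbs ≤ torusDist p q :=
  Finset.single_le_sum (f := fun j => (circlePos (p j) (q j)).natAbs) (fun _ _ => Nat.zero_le _)
    (Finset.mem_univ j)

/-- Additivity of the ℓ¹ distance: contracting one coordinate lowers it by exactly the length swept.
This keeps the cone inequality free of a factor `D`. -/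
theorem torusDist_update_self (p q : Fin D → ZMod L) (j : Fin D) :
    torusDist p (Function.update q j (p j)) + (circlePos (p j) (q j)).natAbs = torusDist p q := by
  rw [torusDist, torusDist, ← Finset.add_sum_erase _ _ (Finset.mem_univ j),
    ← Finset.add_sum_erase (a := j) _ (fun j => (circlePos (p j) (q j)).natAbs) (Finset.mem_univ j)]
  simp only [Function.update_self, circlePos_self, Int.natAbs_zero, zero_add]
  rw [add_comm]
  congr 1
  refine Finset.sum_congr rfl fun l hl => ?_
  rw [Function.update_of_ne (Finset.ne_of_mem_erase hl)]

theorem torusDist_update_le {p q : Fin D → ZMod L} {j : Fin D} {t : ZMod L}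
    (h : (circlePos (p j) t).natAbs ≤ (circlePos (p j) (q j)).natAbs) :
    torusDist p (Function.update q j t) ≤ torusDist p q := by
  refine Finset.sum_le_sum fun l _ => ?_
  by_cases hl : l = j
  · subst hl; simpa using h
  · rw [Function.update_of_ne hl]

theorem IsPure.add {k : ℕ} {z w : CubeChain D L} (hz : IsPure k z) (hw : IsPure k w) :
    IsPure k (z + w) := by
  intro c hc
  by_cases h : z c = 0
  · refine hw c fun h' => hc ?_
    rw [Pi.add_apply, h, h', add_zero]
  · exact hz c h

theorem chain_add_self (z : CubeChain D L) : z + z = 0 := CharTwo.add_self_eq_zero z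

theorem bdry_ne_zero {z : CubeChain D L} {c : CubeCell D L} (h : bdry z c ≠ 0) :
    ∃ l ∉ c.2, z (c.1, insert l c.2) ≠ 0 ∨ z (c.1 - Pi.single l 1, insert l c.2) ≠ 0 := by
  rw [bdry_apply_apply] at h
  obtain ⟨l, -, hl⟩ := Finset.exists_ne_zero_of_sum_ne_zero h
  rw [bdryDir_apply] at hl
  split_ifs at hl with h1
  · exact absurd rfl hl
  · refine ⟨l, h1, ?_⟩
    by_contra! h2
    rw [h2.1, h2.2, add_zero] at hl
    exact hl rfl

theorem IsPure.bdry {k : ℕ} {z : CubeChain D L} (hz : IsPure (k + 1) z) : IsPure k (bdry z) := by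
  intro c hc
  obtain ⟨l, hl, h | h⟩ := bdry_ne_zero hc <;>
  · have := hz _ h
    rw [Finset.card_insert_of_notMem hl] at this
    omega

variable [NeZero L]

theorem mem_chainSupp {z : CubeChain D L} {c : CubeCell D L} : c ∈ chainSupp z ↔ z c ≠ 0 := by
  simp [chainSupp]

theorem chainSupp_add_subset (z w : CubeChain D L) :
    chainSupp (z + w) ⊆ chainSupp z ∪ chainSupp w := by
  intro c hc
  rw [Finset.mem_union, mem_chainSupp, mem_chainSupp]
  rw [mem_chainSupp, Pi.add_apply] at hc
  by_contra! h
  rw [h.1, h.2, add_zero] at hc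
  exact hc rfl

theorem chainMass_add_le (z w : CubeChain D L) :
    chainMass (z + w) ≤ chainMass z + chainMass w :=
  (Finset.card_le_card (chainSupp_add_subset z w)).trans (Finset.card_union_le _ _)

theorem chainMass_eq_zero {z : CubeChain D L} : chainMass z = 0 ↔ z = 0 := by
  rw [chainMass, Finset.card_eq_zero]
  refine ⟨fun h => ?_, fun h => by simp [h, chainSupp]⟩
  ext c
  by_contra hc
  exact absurd (mem_chainSupp.2 hc) (by simp [h])

theorem coneDir_ne_zero {p : Fin D → ZMod L} {j : Fin D} {z : CubeChain D L} {c : CubeCell D L}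
    (h : coneDir p j z c ≠ 0) : ∃ c', z c' ≠ 0 ∧ j ∉ c'.2 ∧ ∃ t, arcCoeff (p j) t (c'.1 j) ≠ 0 ∧
      c = (Function.update c'.1 j t, insert j c'.2) := by
  rw [coneDir_apply] at h
  split_ifs at h with h1
  · obtain ⟨v, -, hv⟩ := Finset.exists_ne_zero_of_sum_ne_zero h
    refine ⟨_, right_ne_zero_of_mul hv, Finset.notMem_erase _ _, c.1 j, ?_, ?_⟩
    · simpa using left_ne_zero_of_mul hv
    · simp [Finset.insert_erase h1]
  · exact absurd rfl h

theorem collapse_ne_zero {p : Fin D → ZMod L} {j : Fin D} {z : CubeChain D L} {c : CubeCell D L}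
    (h : collapse p j z c ≠ 0) :
    (j ∈ c.2 ∧ z (Function.update c.1 j (antipode (p j)), c.2) ≠ 0) ∨
      (j ∉ c.2 ∧ ∃ c', z c' ≠ 0 ∧ c = (Function.update c'.1 j (p j), c'.2)) := by
  rw [collapse] at h
  split_ifs at h with h1 h2
  · exact Or.inl ⟨h1, h⟩
  · obtain ⟨v, -, hv⟩ := Finset.exists_ne_zero_of_sum_ne_zero h
    refine Or.inr ⟨h1, _, hv, ?_⟩
    simp [← h2]
  · exact absurd rfl h

theorem IsPure.coneDir {k : ℕ} {z : CubeChain D L} (hz : IsPure k z) (p : Fin D → ZMod L)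
    (j : Fin D) : IsPure (k + 1) (coneDir p j z) := by
  intro c hc
  obtain ⟨c', h1, h2, t, -, rfl⟩ := coneDir_ne_zero hc
  rw [Finset.card_insert_of_notMem h2, hz _ h1]

theorem IsPure.collapse {k : ℕ} {z : CubeChain D L} (hz : IsPure k z) (p : Fin D → ZMod L)
    (j : Fin D) : IsPure k (collapse p j z) := by
  intro c hc
  obtain ⟨-, h⟩ | ⟨-, c', h1, rfl⟩ := collapse_ne_zero hc
  · exact hz (Function.update c.1 j (antipode (p j)), c.2) h
  · exact hz c' h1

/-! ### The cone inequality -/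

theorem chainMass_coneDir_le (p : Fin D → ZMod L) (j : Fin D) (z : CubeChain D L) :
    chainMass (coneDir p j z) ≤ ∑ c ∈ chainSupp z, (circlePos (p j) (c.1 j)).natAbs := by
  have hsub : chainSupp (coneDir p j z) ⊆ (chainSupp z).biUnion fun c =>
      (Finset.univ.filter fun t => arcCoeff (p j) t (c.1 j) ≠ 0).image fun t =>
        (Function.update c.1 j t, insert j c.2) := by
    intro c hc
    obtain ⟨c', h1, -, t, h2, rfl⟩ := coneDir_ne_zero (mem_chainSupp.1 hc)
    rw [Finset.mem_biUnion]
    exact ⟨c', mem_chainSupp.2 h1, Finset.mem_image_of_mem _ (by simpa using h2)⟩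
  refine (Finset.card_le_card hsub).trans (Finset.card_biUnion_le.trans ?_)
  exact Finset.sum_le_sum fun c _ => Finset.card_image_le.trans (card_arcCoeff_ne_zero_le _ _)

/-- Below radius `L / 2` no opposite edge is met, so `collapse` is an honest projection. -/
theorem not_antipode_of_torusDist_le {p : Fin D → ZMod L} {r : ℕ} (hr : r < L / 2) {j : Fin D}
    {q : Fin D → ZMod L} (h : torusDist p q ≤ r) : q j ≠ antipode (p j) := by
  intro h'
  have := natAbs_circlePos_le_torusDist p q j
  rw [h', circlePos_antipode] at this
  omega

theorem collapse_ne_zero_of_torusDist_le {p : Fin D → ZMod L} {r : ℕ} (hr : r < L / 2) {j : Fin D}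
    {z : CubeChain D L} (hz : ∀ c, z c ≠ 0 → torusDist p c.1 ≤ r) {c : CubeCell D L}
    (h : collapse p j z c ≠ 0) :
    j ∉ c.2 ∧ ∃ c', z c' ≠ 0 ∧ c = (Function.update c'.1 j (p j), c'.2) := by
  obtain ⟨-, h⟩ | h := collapse_ne_zero h
  · exact absurd (by simp) (not_antipode_of_torusDist_le hr (hz _ h) (j := j))
  · exact h

theorem sum_torusDist_collapse_le {p : Fin D → ZMod L} {r : ℕ} (hr : r < L / 2) (j : Fin D)
    {z : CubeChain D L} (hz : ∀ c, z c ≠ 0 → torusDist p c.1 ≤ r) :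
    ∑ c ∈ chainSupp (collapse p j z), torusDist p c.1 ≤
      ∑ c ∈ chainSupp z, torusDist p (Function.update c.1 j (p j)) := by
  classical
  have hsub : chainSupp (collapse p j z) ⊆ (chainSupp z).image fun c =>
      (Function.update c.1 j (p j), c.2) := by
    intro c hc
    obtain ⟨-, c', h1, rfl⟩ := collapse_ne_zero_of_torusDist_le hr hz (mem_chainSupp.1 hc)
    exact Finset.mem_image_of_mem _ (mem_chainSupp.2 h1)
  refine (Finset.sum_le_sum_of_subset hsub).trans ?_
  exact Finset.sum_image_le_of_nonneg (f := fun c : CubeCell D L => torusDist p c.1)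
    (g := fun c : CubeCell D L => ((Function.update c.1 j (p j), c.2) : CubeCell D L))
    (fun _ _ => Nat.zero_le _)

/-- The coordinates in `S` are contracted one at a time. The sum of the distances to `p` over the
cells of the remaining cycle is a potential whose decrease pays for the mass swept. -/
theorem exists_partial_cone {k r : ℕ} {p : Fin D → ZMod L} (hr : r < L / 2) {z : CubeChain D L}
    (hk : IsPure k z) (hz : ∀ c, z c ≠ 0 → torusDist p c.1 ≤ r) (hb : bdry z = 0)
    (S : Finset (Fin D)) :
    ∃ w z' : CubeChain D L, bdry w = z + z' ∧ IsPure (k + 1) w ∧ IsPure k z' ∧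
      (∀ c, w c ≠ 0 → torusDist p c.1 ≤ r) ∧ (∀ c, z' c ≠ 0 → torusDist p c.1 ≤ r) ∧
      (∀ c, z' c ≠ 0 → ∀ j ∈ S, j ∉ c.2) ∧
      chainMass w + ∑ c ∈ chainSupp z', torusDist p c.1 ≤ ∑ c ∈ chainSupp z, torusDist p c.1 := by
  induction S using Finset.induction_on with
  | empty =>
    refine ⟨0, z, by rw [map_zero, chain_add_self], fun c h => absurd rfl h, hk,
      fun c h => absurd rfl h, hz, fun c _ j hj => by simp at hj, ?_⟩
    rw [chainMass_eq_zero.2 rfl, zero_add]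
  | insert j S _ ih =>
    obtain ⟨w, z', h1, h2, h3, h4, h5, h6, h7⟩ := ih
    have hb' : bdry z' = 0 := by
      have := bdry_bdry w
      rwa [h1, map_add, hb, zero_add] at this
    have hcone := bdry_coneDir p j z'
    rw [hb', map_zero, add_zero] at hcone
    refine ⟨w + coneDir p j z', collapse p j z', ?_, h2.add (h3.coneDir p j), h3.collapse p j,
      ?_, ?_, ?_, ?_⟩
    · rw [map_add, h1, hcone, add_assoc, ← add_assoc z', chain_add_self, zero_add]
    · intro c hc
      rw [← mem_chainSupp] at hc
      obtain hc | hc := Finset.mem_union.1 (chainSupp_add_subset _ _ hc)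
      · exact h4 c (mem_chainSupp.1 hc)
      · obtain ⟨c', g1, -, t, g2, rfl⟩ := coneDir_ne_zero (mem_chainSupp.1 hc)
        exact (torusDist_update_le (natAbs_circlePos_le_of_arcCoeff_ne_zero g2)).trans (h5 _ g1)
    · intro c hc
      obtain ⟨-, c', g1, rfl⟩ := collapse_ne_zero_of_torusDist_le hr h5 hc
      exact (torusDist_update_le (by simp)).trans (h5 _ g1)
    · intro c hc l hl
      obtain ⟨g0, c', g1, rfl⟩ := collapse_ne_zero_of_torusDist_le hr h5 hc
      obtain rfl | hl := Finset.mem_insert.1 hl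
      · exact g0
      · exact h6 _ g1 l hl
    · have g1 := chainMass_add_le w (coneDir p j z')
      have g2 := chainMass_coneDir_le p j z'
      have g3 := sum_torusDist_collapse_le hr j h5
      have g4 : ∑ c ∈ chainSupp z', torusDist p (Function.update c.1 j (p j)) +
          ∑ c ∈ chainSupp z', (circlePos (p j) (c.1 j)).natAbs =
          ∑ c ∈ chainSupp z', torusDist p c.1 := by
        rw [← Finset.sum_add_distrib]
        exact Finset.sum_congr rfl fun c _ => torusDist_update_self p c.1 j
      omega

/-- The cone inequality: a cycle in a ball of radius `r` bounds a chain of at most `r` times its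
mass in the same ball. -/
theorem exists_cone {k r : ℕ} {p : Fin D → ZMod L} (hr : r < L / 2) {z : CubeChain D L}
    (hk : IsPure (k + 1) z) (hz : ∀ c, z c ≠ 0 → torusDist p c.1 ≤ r) (hb : bdry z = 0) :
    ∃ w : CubeChain D L, bdry w = z ∧ IsPure (k + 2) w ∧ chainMass w ≤ r * chainMass z := by
  obtain ⟨w, z', h1, h2, h3, -, -, h6, h7⟩ := exists_partial_cone hr hk hz hb Finset.univ
  -- After all coordinates are contracted only vertices could remain, and the chain has positive
  -- dimension.
  have hz' : z' = 0 := by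
    ext c
    by_contra hc
    have g1 := h3 c hc
    have g2 : c.2 = ∅ := Finset.eq_empty_of_forall_notMem fun j => h6 c hc j (Finset.mem_univ j)
    rw [g2, Finset.card_empty] at g1
    omega
  refine ⟨w, by rw [h1, hz', add_zero], h2, ?_⟩
  have : ∑ c ∈ chainSupp z, torusDist p c.1 ≤ ∑ c ∈ chainSupp z, r :=
    Finset.sum_le_sum fun c hc => hz c (mem_chainSupp.1 hc)
  rw [Finset.sum_const, smul_eq_mul, mul_comm] at this
  exact (Nat.le_add_right _ _).trans (h7.trans this)

/-! ### The homology of the torus -/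

/-- The number mod 2 of the cells of `z` in the directions `I` that lie over the cell of the
subtorus spanned by `I` with base point `a`. -/
def subtorusDegree (a : Fin D → ZMod L) (I : Finset (Fin D)) (z : CubeChain D L) : ZMod 2 :=
  ∑ q with ∀ j ∈ I, q j = a j, z (q, I)

theorem subtorusDegree_add (a : Fin D → ZMod L) (I : Finset (Fin D)) (z w : CubeChain D L) :
    subtorusDegree a I (z + w) = subtorusDegree a I z + subtorusDegree a I w :=
  Finset.sum_add_distrib

/-- The degree is a homology invariant: the two terms of `bdryDir l` with `l ∉ I` are translates
along `l`, which preserves the fibre, and so have equal sums. -/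
theorem subtorusDegree_bdry (a : Fin D → ZMod L) (I : Finset (Fin D)) (w : CubeChain D L) :
    subtorusDegree a I (bdry w) = 0 := by
  simp only [subtorusDegree, bdry_apply_apply]
  rw [Finset.sum_comm]
  refine Finset.sum_eq_zero fun l _ => ?_
  simp only [bdryDir_apply]
  by_cases hl : l ∈ I
  · simp [hl]
  · simp only [hl, if_false, Finset.sum_add_distrib]
    rw [← CharTwo.add_self_eq_zero (∑ q with ∀ j ∈ I, q j = a j, w (q, insert l I))]
    congr 1
    refine Finset.sum_equiv (Equiv.subRight (Pi.single l 1)) (fun q => ?_) (fun q _ => rfl)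
    simp only [Finset.mem_filter, Finset.mem_univ, true_and, Equiv.subRight_apply]
    refine forall₂_congr fun j hj => ?_
    have : j ≠ l := fun h => hl (h ▸ hj)
    simp [this]

/-- A chain is a multiple of the subtorus through `p` in each set of directions, as far as the
coordinates in `S` are concerned. -/
def IsSubtorusChain (p : Fin D → ZMod L) (S : Finset (Fin D)) (z : CubeChain D L) : Prop :=
  ∀ j ∈ S, (∀ c : CubeCell D L, j ∈ c.2 → ∀ v, z (Function.update c.1 j v, c.2) = z c) ∧
    ∀ c : CubeCell D L, j ∉ c.2 → c.1 j ≠ p j → z c = 0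

theorem IsSubtorusChain.collapse {p : Fin D → ZMod L} {S : Finset (Fin D)} {z : CubeChain D L}
    (h : IsSubtorusChain p S z) (j : Fin D) :
    IsSubtorusChain p (insert j S) (collapse p j z) := by
  intro l hl
  by_cases hlj : l = j
  · subst hlj
    refine ⟨fun c hc v => ?_, fun c hc hp => ?_⟩
    · simp [_root_.collapse, hc]
    · simp [_root_.collapse, hc, hp]
  · obtain ⟨h1, h2⟩ := h l (Finset.mem_of_mem_insert_of_ne hl hlj)
    refine ⟨fun c hc v => ?_, fun c hc hp => ?_⟩
    · simp only [_root_.collapse, Function.update_of_ne (Ne.symm hlj)]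
      split_ifs
      · rw [Function.update_comm hlj]
        exact h1 (Function.update c.1 j (antipode (p j)), c.2) hc v
      · refine Finset.sum_congr rfl fun t _ => ?_
        rw [Function.update_comm hlj]
        exact h1 (Function.update c.1 j t, c.2) hc v
      · rfl
    · simp only [_root_.collapse]
      split_ifs
      · exact h2 (_, c.2) hc (by simpa [hlj] using hp)
      · exact Finset.sum_eq_zero fun t _ => h2 (_, c.2) hc (by simpa [hlj] using hp)
      · rfl

/-- The same successive contraction as for cones, now without a size restriction: an opposite edge
that is met gets stretched over its whole circle. -/
theorem exists_subtorusChain {k : ℕ} (p : Fin D → ZMod L) {z : CubeChain D L}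
    (hk : IsPure k z) (hb : bdry z = 0) (S : Finset (Fin D)) :
    ∃ w z' : CubeChain D L, bdry w = z + z' ∧ IsPure (k + 1) w ∧ IsPure k z' ∧
      IsSubtorusChain p S z' := by
  induction S using Finset.induction_on with
  | empty =>
    exact ⟨0, z, by rw [map_zero, chain_add_self], fun c h => absurd rfl h, hk,
      fun j hj => by simp at hj⟩
  | insert j S _ ih =>
    obtain ⟨w, z', h1, h2, h3, h4⟩ := ih
    have hb' : bdry z' = 0 := by
      have := bdry_bdry w
      rwa [h1, map_add, hb, zero_add] at this
    have hcone := bdry_coneDir p j z'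
    rw [hb', map_zero, add_zero] at hcone
    refine ⟨w + coneDir p j z', collapse p j z', ?_, h2.add (h3.coneDir p j), h3.collapse p j,
      h4.collapse j⟩
    rw [map_add, h1, hcone, add_assoc, ← add_assoc z', chain_add_self, zero_add]

omit [NeZero L] in
theorem IsSubtorusChain.apply_piecewise {p : Fin D → ZMod L} {z : CubeChain D L}
    (h : IsSubtorusChain p Finset.univ z) (a q : Fin D → ZMod L) (I : Finset (Fin D))
    {T : Finset (Fin D)} (hT : T ⊆ I) : z (T.piecewise a q, I) = z (q, I) := by
  induction T using Finset.induction_on with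
  | empty => simp
  | insert j T _ ih =>
    rw [Finset.piecewise_insert]
    rw [← ih ((Finset.subset_insert _ _).trans hT)]
    exact (h j (Finset.mem_univ j)).1 (T.piecewise a q, I) (hT (Finset.mem_insert_self _ _)) _

/-- Only one cell of each fibre can carry a nonzero coefficient, the one whose coordinates outside
`c.2` agree with `p`; hence the degrees determine the chain. -/
theorem IsSubtorusChain.subtorusDegree_eq {p : Fin D → ZMod L} {z : CubeChain D L}
    (h : IsSubtorusChain p Finset.univ z) {c : CubeCell D L} (hc : z c ≠ 0)
    (a : Fin D → ZMod L) : subtorusDegree a c.2 z = z c := by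
  have hp : ∀ q, z (q, c.2) ≠ 0 → ∀ j ∉ c.2, q j = p j := fun q hq j hj => by
    by_contra hqp
    exact hq ((h j (Finset.mem_univ j)).2 (q, c.2) hj hqp)
  rw [subtorusDegree, Finset.sum_eq_single (c.2.piecewise a c.1)]
  · exact h.apply_piecewise a c.1 c.2 subset_rfl
  · intro q hq hne
    by_contra hq0
    refine hne (funext fun j => ?_)
    by_cases hj : j ∈ c.2
    · rw [Finset.piecewise_eq_of_mem _ _ _ hj]
      exact (Finset.mem_filter.1 hq).2 j hj
    · rw [Finset.piecewise_eq_of_notMem _ _ _ hj, hp q hq0 j hj, hp c.1 hc j hj]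
  · intro hq
    refine absurd (Finset.mem_filter.2 ⟨Finset.mem_univ _, fun j hj => ?_⟩) hq
    rw [Finset.piecewise_eq_of_mem _ _ _ hj]

/-- A cycle that misses a cell of each coordinate subtorus is a boundary. -/
theorem exists_bdry_eq_of_missed {k : ℕ} {z : CubeChain D L} (hk : IsPure k z) (hb : bdry z = 0)
    (hz : ∀ I : Finset (Fin D), I.card = k →
      ∃ a : Fin D → ZMod L, ∀ q, (∀ j ∈ I, q j = a j) → z (q, I) = 0) :
    ∃ w : CubeChain D L, bdry w = z ∧ IsPure (k + 1) w := by
  obtain ⟨w, z', h1, h2, h3, h4⟩ := exists_subtorusChain 0 hk hb Finset.univ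
  have hz' : z' = 0 := by
    ext c
    by_contra hc
    obtain ⟨a, ha⟩ := hz c.2 (h3 c hc)
    -- The base point `a` is free, so the degree is evaluated over the missed cell.
    have g := subtorusDegree_bdry a c.2 w
    rw [h1, subtorusDegree_add, h4.subtorusDegree_eq hc] at g
    have : subtorusDegree a c.2 z = 0 :=
      Finset.sum_eq_zero fun q hq => ha q (Finset.mem_filter.1 hq).2
    rw [this, zero_add] at g
    exact hc g
  exact ⟨w, by rw [h1, hz', add_zero], h2⟩

end Support

/-! ### Growth of balls -/

theorem succ_pow_le (T k : ℕ) (hT : 1 ≤ T) :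
    (T + 1) ^ (k + 1) ≤ T ^ (k + 1) + 2 ^ (k + 1) * T ^ k := by
  induction k with
  | zero => simp
  | succ k ih =>
    have h1 : T ^ (k + 1) ≤ (2 * T) ^ (k + 1) := Nat.pow_le_pow_left (by omega) _
    have h2 : 2 ^ (k + 1) * T ^ k ≤ 2 ^ (k + 1) * T ^ (k + 1) :=
      Nat.mul_le_mul_left _ (Nat.pow_le_pow_right hT (Nat.le_succ k))
    have h3 : T ^ (k + 1) ≤ 2 ^ (k + 1) * T ^ (k + 1) := Nat.le_mul_of_pos_left _ (by positivity)
    calc (T + 1) ^ (k + 1 + 1) = (T + 1) ^ (k + 1) * T + (T + 1) ^ (k + 1) := by ring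
      _ ≤ (T ^ (k + 1) + 2 ^ (k + 1) * T ^ k) * T + (T + 1) ^ (k + 1) := by gcongr
      _ ≤ (T ^ (k + 1) + 2 ^ (k + 1) * T ^ k) * T + (2 * T) ^ (k + 1) := by
        gcongr; omega
      _ = T ^ (k + 1 + 1) + 2 ^ (k + 1 + 1) * T ^ (k + 1) := by rw [mul_pow]; ring

/-- A discrete differential inequality with polynomial growth. -/
theorem exists_growth (k b K : ℕ) (hb : 0 < b) : ∃ E M : ℕ, 0 < E ∧ 0 < M ∧
    ∀ (f m : ℕ → ℕ) (R : ℕ), 1 ≤ f 0 → (∀ r < R, m r + b * f r ≤ b * f (r + 1)) →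
      (∀ r < R, (r / E) ^ k < K * m r ∨ f r < 2 * (r / E) * m r) →
      (R / E) ^ (k + 1) ≤ M * f R := by
  -- In a block of `E` consecutive radii the quotient `r / E = T` is constant and `m` is at least `T
  -- ^ k / (2 * (K + 1))`. The factor `E` makes the gain of `f` over the block at least `2 ^ (k + 1)
  -- * T ^ k / (K + 1)`, enough for `succ_pow_le`.
  refine ⟨2 * b * 2 ^ (k + 1), K + 1, by positivity, by positivity, ?_⟩
  set E := 2 * b * 2 ^ (k + 1) with hE
  have hEpos : 0 < E := by positivity
  intro f m R h0 hm hbad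
  have hmono : ∀ r ≤ R, ∀ r' ≤ r, f r' ≤ f r := by
    intro r hr
    induction r with
    | zero => intro r' h; rw [Nat.le_zero.1 h]
    | succ r ih =>
      intro r' h
      have h1 : f r ≤ f (r + 1) :=
        Nat.le_of_mul_le_mul_left ((Nat.le_add_left _ _).trans (hm r (by omega))) hb
      obtain h | h := Nat.lt_or_ge r' (r + 1)
      · exact (ih (by omega) r' (by omega)).trans h1
      · rw [le_antisymm ‹_› h]
  have key : ∀ T, E * T ≤ R → T ^ (k + 1) ≤ (K + 1) * f (E * T) := by
    intro T
    induction T with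
    | zero => intro _; simp
    | succ T ih =>
      intro hT
      have hT' : E * T + E ≤ R := hT
      have ih := ih (by omega)
      -- The first block gives no usable gain, since the argument below divides by `T`; there `1 ≤ f
      -- 0` suffices.
      obtain rfl | hTpos := Nat.eq_zero_or_pos T
      · have := hmono _ hT 0 (Nat.zero_le _)
        simp only [zero_add, one_pow]
        simp only [zero_add] at this
        nlinarith
      have step : ∀ e ≤ E, 2 * (K + 1) * b * f (E * T) + e * T ^ k ≤
          2 * (K + 1) * b * f (E * T + e) := by
        intro e
        induction e with
        | zero => intro _; simp
        | succ e ihe =>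
          intro he
          have ihe := ihe (by omega)
          have hr : E * T + e < R := by omega
          have hdiv : (E * T + e) / E = T := by
            rw [Nat.mul_add_div hEpos, Nat.div_eq_of_lt (by omega), add_zero]
          have h1 := hm _ hr
          have h2 : T ^ k ≤ 2 * (K + 1) * m (E * T + e) := by
            obtain h | h := hbad _ hr
            · rw [hdiv] at h
              nlinarith
            -- Here `m` is large relative to `f`, and the induction hypothesis bounds `f` below.
            · rw [hdiv] at h
              have h3 := hmono _ hr.le (E * T) (by omega)
              have h4 : T * T ^ k ≤ T * (2 * (K + 1) * m (E * T + e)) := by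
                calc T * T ^ k = T ^ (k + 1) := by ring
                  _ ≤ (K + 1) * f (E * T) := ih
                  _ ≤ (K + 1) * (2 * T * m (E * T + e)) :=
                    Nat.mul_le_mul_left _ (h3.trans h.le)
                  _ = _ := by ring
              exact Nat.le_of_mul_le_mul_left h4 hTpos
          have h5 := Nat.mul_le_mul_left (2 * (K + 1)) h1
          calc 2 * (K + 1) * b * f (E * T) + (e + 1) * T ^ k
              = (2 * (K + 1) * b * f (E * T) + e * T ^ k) + T ^ k := by ring
            _ ≤ 2 * (K + 1) * b * f (E * T + e) + 2 * (K + 1) * m (E * T + e) := by gcongr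
            _ = 2 * (K + 1) * (m (E * T + e) + b * f (E * T + e)) := by ring
            _ ≤ 2 * (K + 1) * (b * f (E * T + e + 1)) := h5
            _ = 2 * (K + 1) * b * f (E * T + e + 1) := by ring
      have h1 := step E le_rfl
      have h2 : 2 * b * (T + 1) ^ (k + 1) ≤ 2 * b * ((K + 1) * f (E * (T + 1))) := by
        calc 2 * b * (T + 1) ^ (k + 1) ≤ 2 * b * (T ^ (k + 1) + 2 ^ (k + 1) * T ^ k) :=
              Nat.mul_le_mul_left _ (succ_pow_le T k hTpos)
          _ = 2 * b * T ^ (k + 1) + E * T ^ k := by rw [hE]; ring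
          _ ≤ 2 * b * ((K + 1) * f (E * T)) + E * T ^ k := by gcongr
          _ = 2 * (K + 1) * b * f (E * T) + E * T ^ k := by ring
          _ ≤ _ := h1
          _ = _ := by rw [mul_add_one E T]; ring
      exact Nat.le_of_mul_le_mul_left h2 (by positivity)
  refine (key (R / E) (Nat.mul_div_le R E)).trans ?_
  exact Nat.mul_le_mul_left _ (hmono R le_rfl _ (Nat.mul_div_le R E))

/-! ### Slicing by balls -/

/-- The faces of codimension one of a cell. -/
def cellFaces {D L : ℕ} (c : CubeCell D L) : Finset (CubeCell D L) :=
  (c.2 ×ˢ Finset.univ).image fun x : Fin D × Fin 2 => torusFace c x.1 x.2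

/-- The part of a chain in the ball of radius `r` about `p`. -/
def ballPart {D L : ℕ} (p : Fin D → ZMod L) (r : ℕ) (z : CubeChain D L) : CubeChain D L :=
  fun c => if torusDist p c.1 ≤ r then z c else 0

section Slices

variable {D L : ℕ}

theorem torusDist_triangle (p q r : Fin D → ZMod L) :
    torusDist p r ≤ torusDist p q + torusDist q r := by
  rw [torusDist, torusDist, torusDist, ← Finset.sum_add_distrib]
  refine Finset.sum_le_sum fun j _ => ?_
  have h := ZMod.natAbs_valMinAbs_add_le (q j - p j) (r j - q j)
  rw [sub_add_sub_cancel'] at h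
  exact h.trans (Int.natAbs_add_le _ _)

theorem card_cellFaces_le (c : CubeCell D L) : (cellFaces c).card ≤ 2 * c.2.card := by
  refine Finset.card_image_le.trans ?_
  rw [Finset.card_product, Finset.card_univ, Fintype.card_fin, mul_comm]

theorem exists_mem_cellFaces_of_bdry_ne_zero {z : CubeChain D L} {f : CubeCell D L}
    (h : bdry z f ≠ 0) : ∃ c, z c ≠ 0 ∧ f ∈ cellFaces c := by
  obtain ⟨l, hl, h | h⟩ := bdry_ne_zero h
  · refine ⟨_, h, Finset.mem_image.2 ⟨(l, 0), by simp, ?_⟩⟩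
    simp [torusFace, Finset.erase_insert hl]
  · refine ⟨_, h, Finset.mem_image.2 ⟨(l, 1), by simp, ?_⟩⟩
    simp [torusFace, Finset.erase_insert hl]

theorem ballPart_ne_zero {p : Fin D → ZMod L} {r : ℕ} {z : CubeChain D L} {c : CubeCell D L} :
    ballPart p r z c ≠ 0 ↔ torusDist p c.1 ≤ r ∧ z c ≠ 0 := by
  simp [ballPart]

theorem add_ballPart_ne_zero {p : Fin D → ZMod L} {r : ℕ} {z : CubeChain D L} {c : CubeCell D L} :
    (z + ballPart p r z) c ≠ 0 ↔ ¬ torusDist p c.1 ≤ r ∧ z c ≠ 0 := by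
  rw [Pi.add_apply, ballPart]
  split_ifs with h <;> simp [h, CharTwo.add_self_eq_zero]

theorem IsPure.ballPart {k : ℕ} {z : CubeChain D L} (hz : IsPure k z) (p : Fin D → ZMod L) (r : ℕ) :
    IsPure k (ballPart p r z) := fun c hc => hz c (ballPart_ne_zero.1 hc).2

variable [NeZero L]

theorem torusDist_add_single_le (q : Fin D → ZMod L) (l : Fin D) :
    torusDist q (q + Pi.single l 1) ≤ 1 := by
  rw [torusDist, Finset.sum_eq_single l]
  · simp only [circlePos, Pi.add_apply, Pi.single_eq_same, add_sub_cancel_left]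
    have h1 : 0 < L := Nat.pos_of_ne_zero (NeZero.ne L)
    obtain h | h : L = 1 ∨ 1 ≤ L / 2 := by omega
    · subst h
      rw [Subsingleton.elim (1 : ZMod 1) 0]
      simp
    · have := ZMod.valMinAbs_natCast_of_le_half h
      rw [Nat.cast_one] at this
      rw [this]
      rfl
  · intro j _ hj
    simp [circlePos, hj]
  · intro h
    exact absurd (Finset.mem_univ _) h

theorem torusDist_le_one_of_mem_cellFaces {c f : CubeCell D L} (h : f ∈ cellFaces c) :
    torusDist c.1 f.1 ≤ 1 := by
  obtain ⟨⟨l, s⟩, -, rfl⟩ := Finset.mem_image.1 h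
  simp only [torusFace]
  split_ifs
  · exact torusDist_add_single_le _ _
  · simp [torusDist_self]

theorem torusDist_le_of_bdry_ballPart {p : Fin D → ZMod L} {r : ℕ} {w : CubeChain D L}
    {f : CubeCell D L} (h : bdry (ballPart p r w) f ≠ 0) : torusDist p f.1 ≤ r + 1 := by
  obtain ⟨c, h1, h2⟩ := exists_mem_cellFaces_of_bdry_ne_zero h
  have h3 := torusDist_le_one_of_mem_cellFaces h2
  have h4 := torusDist_triangle p c.1 f.1
  have h5 := (ballPart_ne_zero.1 h1).1
  omega

theorem chainMass_ballPart_le (p : Fin D → ZMod L) (r : ℕ) (w : CubeChain D L) :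
    chainMass (ballPart p r w) ≤ chainMass w :=
  Finset.card_le_card fun _ hc =>
    mem_chainSupp.2 (ballPart_ne_zero.1 (mem_chainSupp.1 hc)).2

theorem chainMass_add_ballPart (p : Fin D → ZMod L) (r : ℕ) (w : CubeChain D L) :
    chainMass (w + ballPart p r w) + chainMass (ballPart p r w) = chainMass w := by
  rw [chainMass, chainMass, ← Finset.card_union_of_disjoint]
  · congr 1
    ext c
    rw [Finset.mem_union, mem_chainSupp, mem_chainSupp, mem_chainSupp, add_ballPart_ne_zero,
      ballPart_ne_zero]
    tauto
  · rw [Finset.disjoint_left]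
    intro c h1 h2
    exact (add_ballPart_ne_zero.1 (mem_chainSupp.1 h1)).1
      (ballPart_ne_zero.1 (mem_chainSupp.1 h2)).1

/-- A discrete coarea inequality. Away from `bdry w`, a cell of the slice is also a face of a cell
of `w` outside the ball. Base points of a cell and its face differ by at most 1, so the outside cell
lies in the next shell of width 2; it has at most `2 * (k + 1)` faces. -/
theorem chainMass_bdry_ballPart_le {k r : ℕ} {p : Fin D → ZMod L} {w : CubeChain D L}
    (hw : IsPure (k + 1) w) (hr : ∀ c, bdry w c ≠ 0 → 2 * r + 1 < torusDist p c.1) :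
    chainMass (bdry (ballPart p (2 * r) w)) + 2 * (k + 1) * chainMass (ballPart p (2 * r) w) ≤
      2 * (k + 1) * chainMass (ballPart p (2 * (r + 1)) w) := by
  set u := ballPart p (2 * r) w
  set u' := ballPart p (2 * (r + 1)) w
  have hsub : chainSupp u ⊆ chainSupp u' := by
    intro c hc
    rw [mem_chainSupp, ballPart_ne_zero] at hc ⊢
    exact ⟨by omega, hc.2⟩
  have hfaces : chainSupp (bdry u) ⊆ (chainSupp u' \ chainSupp u).biUnion cellFaces := by
    intro f hf
    rw [mem_chainSupp] at hf
    have h1 := torusDist_le_of_bdry_ballPart hf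
    have h2 : bdry w f = 0 := by
      by_contra h
      have := hr f h
      omega
    have h3 : bdry (w + u) f ≠ 0 := by
      rw [map_add, Pi.add_apply, h2, zero_add]
      exact hf
    obtain ⟨c, h4, h5⟩ := exists_mem_cellFaces_of_bdry_ne_zero h3
    rw [add_ballPart_ne_zero] at h4
    refine Finset.mem_biUnion.2 ⟨c, ?_, h5⟩
    rw [Finset.mem_sdiff, mem_chainSupp, mem_chainSupp, ballPart_ne_zero, ballPart_ne_zero]
    have h6 := torusDist_triangle p f.1 c.1
    have h7 := torusDist_le_one_of_mem_cellFaces h5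
    rw [torusDist_comm] at h7
    exact ⟨⟨by omega, h4.2⟩, fun h => h4.1 h.1⟩
  have hcard : chainMass (bdry u) ≤ (chainSupp u' \ chainSupp u).card * (2 * (k + 1)) := by
    refine (Finset.card_le_card hfaces).trans (Finset.card_biUnion_le_card_mul _ _ _ ?_)
    intro c hc
    have h1 := (ballPart_ne_zero.1 (mem_chainSupp.1 (Finset.mem_sdiff.1 hc).1)).2
    rw [← hw c h1]
    exact card_cellFaces_le c
  have h1 : chainMass u' = (chainSupp u' \ chainSupp u).card + chainMass u :=
    (Finset.card_sdiff_add_card_eq_card hsub).symm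
  rw [h1, mul_add (2 * (k + 1)), mul_comm (2 * (k + 1)) (Finset.card _)]
  exact Nat.add_le_add_right hcard _

end Slices

/-! ### The isoperimetric inequality -/

/-- `k`-cycles of mass at most `s ^ k / K` can be filled with mass at most `s` times theirs. -/
def FillingMassBound (k K : ℕ) : Prop :=
  ∀ (D L : ℕ) [NeZero L] (z : CubeChain D L) (s : ℕ), s ≤ L → IsPure k z → bdry z = 0 →
    K * chainMass z ≤ s ^ k →
    ∃ w : CubeChain D L, bdry w = z ∧ IsPure (k + 1) w ∧ chainMass w ≤ s * chainMass z

/-- `k`-cycles of mass at most `s ^ k / K` can be filled with mass at most `s` times theirs,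
within distance `s`. -/
def FillingBound (k K : ℕ) : Prop :=
  ∀ (D L : ℕ) [NeZero L] (z : CubeChain D L) (s : ℕ), s ≤ L → IsPure k z → bdry z = 0 →
    K * chainMass z ≤ s ^ k →
    ∃ w : CubeChain D L, bdry w = z ∧ IsPure (k + 1) w ∧ chainMass w ≤ s * chainMass z ∧
      ∀ c, w c ≠ 0 → ∃ c', z c' ≠ 0 ∧ torusDist c.1 c'.1 ≤ s

/-- A pure chain of least mass among those with the same boundary. -/
def IsMinimalFilling {D L : ℕ} [NeZero L] (k : ℕ) (w : CubeChain D L) : Prop :=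
  IsPure k w ∧ ∀ w' : CubeChain D L, IsPure k w' → bdry w' = bdry w → chainMass w ≤ chainMass w'

theorem exists_isMinimalFilling {D L k : ℕ} [NeZero L] {w : CubeChain D L} (hw : IsPure k w) :
    ∃ w', IsMinimalFilling k w' ∧ bdry w' = bdry w ∧ chainMass w' ≤ chainMass w := by
  obtain ⟨w', ⟨h1, h2⟩, h3⟩ := (measure (chainMass (D := D) (L := L))).wf.has_min
    {w' | IsPure k w' ∧ bdry w' = bdry w} ⟨w, hw, rfl⟩
  refine ⟨w', ⟨h1, fun v hv hb => ?_⟩, h2, ?_⟩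
  · exact not_lt.1 (h3 v ⟨hv, hb.trans h2⟩)
  · exact not_lt.1 (h3 w ⟨hw, rfl⟩)

theorem one_le_chainMass {D L : ℕ} [NeZero L] {z : CubeChain D L} {c : CubeCell D L}
    (h : z c ≠ 0) : 1 ≤ chainMass z := Finset.card_pos.2 ⟨c, mem_chainSupp.2 h⟩

theorem fillingMassBound_zero : FillingMassBound 0 2 := by
  intro D L _ z s _ _ _ h
  have hz : z = 0 := by
    rw [pow_zero] at h
    exact chainMass_eq_zero.1 (by omega)
  subst hz
  exact ⟨0, map_zero _, fun c hc => absurd rfl hc, by simp [chainMass_eq_zero.2 rfl]⟩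

/-- Monotonicity: a minimal filling has a definite mass near each of its cells. -/
theorem exists_monotonicity {k K : ℕ} (hK : FillingMassBound k K) :
    ∃ E M : ℕ, 0 < E ∧ 0 < M ∧ ∀ (D L : ℕ) [NeZero L] (w : CubeChain D L) (p : CubeCell D L)
      (R : ℕ), IsMinimalFilling (k + 1) w → w p ≠ 0 →
      (∀ c, bdry w c ≠ 0 → 2 * R < torusDist p.1 c.1) → R / E ≤ L →
      (R / E) ^ (k + 1) ≤ M * chainMass w := by
  obtain ⟨E, M, hE, hM, hgrow⟩ := exists_growth k (2 * (k + 1)) K (by positivity)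
  refine ⟨E, M, hE, hM, ?_⟩
  intro D L _ w p R hw hp hR hL
  have hpos : ∀ r, ballPart p.1 r w p ≠ 0 := fun r =>
    ballPart_ne_zero.2 ⟨by rw [torusDist_self]; exact Nat.zero_le _, hp⟩
  refine (hgrow (fun r => chainMass (ballPart p.1 (2 * r) w))
    (fun r => chainMass (bdry (ballPart p.1 (2 * r) w))) R (one_le_chainMass (hpos _)) ?_ ?_).trans
    (Nat.mul_le_mul_left _ (chainMass_ballPart_le _ _ _))
  · intro r hr
    refine chainMass_bdry_ballPart_le hw.1 fun c hc => ?_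
    have := hR c hc
    omega
  · intro r hr
    -- Otherwise the slice could be filled by `y` with at most half the mass of `u`, and exchanging
    -- `u` for `y` would beat the minimal `w`.
    by_contra! h
    set u := ballPart p.1 (2 * r) w
    obtain ⟨y, hy1, hy2, hy3⟩ := hK D L (bdry u) (r / E)
      ((Nat.div_le_div_right hr.le).trans hL) (hw.1.ballPart p.1 (2 * r)).bdry (bdry_bdry u) h.1
    have h1 := hw.2 (w + u + y) ((hw.1.add (hw.1.ballPart _ _)).add hy2)
      (by rw [map_add, map_add, hy1, add_assoc, chain_add_self, add_zero])
    have h2 := chainMass_add_le (w + u) y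
    have h3 := chainMass_add_ballPart p.1 (2 * r) w
    have h4 : 1 ≤ chainMass u := one_le_chainMass (hpos _)
    have h5 := h.2
    rw [mul_assoc] at h5
    change chainMass (w + u) + chainMass u = _ at h3
    omega

/-- A cell of a minimal filling farther than `s` from `z` would, by monotonicity, force mass of
order `s ^ (k + 1)`, whereas the filling has mass at most `s * chainMass z`, a small multiple of `s
^ (k + 1)`. -/
theorem FillingMassBound.fillingBound {k K : ℕ} (hK : FillingMassBound k K) :
    ∃ K', FillingBound k K' := by
  obtain ⟨E, M, hE, hM, hmon⟩ := exists_monotonicity hK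
  -- The summand `K` lets `hK` apply; the rest exceeds the monotonicity constant at radius `E * T`,
  -- where `s ≤ 4 * E * T`, and also excludes `s < 2 * E`.
  refine ⟨K + (4 * E) ^ (k + 1) * M + 1, ?_⟩
  intro D L _ z s hs hz hb hsk
  obtain ⟨w₀, h1, h2, h3⟩ := hK D L z s hs hz hb (le_trans (Nat.mul_le_mul_right _ (by omega)) hsk)
  obtain ⟨w, hw, hwb, hwm⟩ := exists_isMinimalFilling h2
  refine ⟨w, hwb.trans h1, hw.1, hwm.trans h3, fun c hc => ?_⟩
  by_contra! hfar
  have hz1 : 1 ≤ chainMass z := by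
    by_contra h
    rw [Nat.lt_one_iff.1 (not_le.1 h)] at h3
    have := one_le_chainMass hc
    omega
  have hEs : 2 * E ≤ s := by
    by_contra! h
    have g1 : s ^ k ≤ (4 * E) ^ k := Nat.pow_le_pow_left (by omega) _
    have g2 : (4 * E) ^ k ≤ (4 * E) ^ (k + 1) := Nat.pow_le_pow_right (by omega) (by omega)
    have g3 : (4 * E) ^ (k + 1) ≤ (4 * E) ^ (k + 1) * M := Nat.le_mul_of_pos_right _ hM
    have g4 := Nat.le_mul_of_pos_right (K + (4 * E) ^ (k + 1) * M + 1) hz1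
    omega
  set T := s / (2 * E)
  have hT1 : 2 * E * T ≤ s := Nat.mul_div_le _ _
  have hT0 : 1 ≤ T := (Nat.one_le_div_iff (by omega)).2 hEs
  have hT2 : s ≤ 4 * E * T := by
    have : s < 2 * E * (T + 1) := Nat.lt_mul_div_succ s (by omega)
    nlinarith
  have hTs : T ≤ s := Nat.div_le_self _ _
  have hdiv : E * T / E = T := Nat.mul_div_cancel_left _ hE
  have h4 := hmon D L w c (E * T) hw hc (fun c' hc' => by
    rw [hwb, h1] at hc'
    have := hfar c' hc'
    nlinarith) (by rw [hdiv]; omega)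
  rw [hdiv] at h4
  have h5 : s * s ^ k ≤ (4 * E) ^ (k + 1) * (M * (s * chainMass z)) := by
    calc s * s ^ k = s ^ (k + 1) := by ring
      _ ≤ (4 * E * T) ^ (k + 1) := Nat.pow_le_pow_left hT2 _
      _ = (4 * E) ^ (k + 1) * T ^ (k + 1) := mul_pow _ _ _
      _ ≤ (4 * E) ^ (k + 1) * (M * (s * chainMass z)) :=
        Nat.mul_le_mul_left _ (h4.trans (Nat.mul_le_mul_left _ (hwm.trans h3)))
  have h6 := Nat.mul_le_mul_left s hsk
  have h7 : 1 ≤ s * chainMass z := Nat.mul_pos (by omega) hz1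
  have h8 : (K + (4 * E) ^ (k + 1) * M + 1) * (s * chainMass z) ≤
      (4 * E) ^ (k + 1) * M * (s * chainMass z) := by
    calc _ = s * ((K + (4 * E) ^ (k + 1) * M + 1) * chainMass z) := by ring
      _ ≤ _ := h6.trans h5
      _ = _ := by ring
  have h9 := Nat.le_of_mul_le_mul_right h8 h7
  omega

/-- A ball with a thin slice is cut off, the slice is closed up by `y`, the small cycle `u + y` is
coned off, and the remainder `z + u + y`, of smaller mass, is filled by induction at the same scale
`s`. The cone costs at most `s / 2` times the mass of `u`, which is covered by `s` times the mass
lost. -/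
theorem FillingBound.fillingMassBound_succ {k K : ℕ} (hK : FillingBound k K) :
    ∃ K', FillingMassBound (k + 1) K' := by
  obtain ⟨E, M, hE, hM, hgrow⟩ := exists_growth k (2 * (k + 1)) K (by positivity)
  -- Ensures for `ρ = 2 * (E * T) + T`, the radius of the cone, both `ρ < L / 2` and `3 * ρ ≤ s`.
  set W := 8 * E + 8 with hW
  refine ⟨M * (2 * W) ^ (k + 1) + 1, ?_⟩
  intro D L _ z s hs hz hb hsk
  induction hn : chainMass z using Nat.strong_induction_on generalizing z with
  | _ n ih =>
  subst hn
  by_cases hz0 : z = 0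
  · subst hz0
    exact ⟨0, map_zero _, fun c hc => absurd rfl hc, by simp [chainMass_eq_zero.2 rfl]⟩
  obtain ⟨p, hp⟩ := Function.ne_iff.1 hz0
  rw [Pi.zero_apply] at hp
  have hz1 := one_le_chainMass hp
  have hpos : ∀ r, ballPart p.1 r z p ≠ 0 := fun r =>
    ballPart_ne_zero.2 ⟨by rw [torusDist_self]; exact Nat.zero_le _, hp⟩
  have hWs : W ≤ s := by
    by_contra! h
    have g1 : s ^ (k + 1) ≤ (2 * W) ^ (k + 1) := Nat.pow_le_pow_left (by omega) _
    have g2 : (2 * W) ^ (k + 1) ≤ M * (2 * W) ^ (k + 1) := Nat.le_mul_of_pos_left _ hM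
    have g3 := Nat.le_mul_of_pos_right (M * (2 * W) ^ (k + 1) + 1) hz1
    omega
  set T := s / W
  have hT1 : W * T ≤ s := Nat.mul_div_le _ _
  have hT0 : 1 ≤ T := (Nat.one_le_div_iff (by omega)).2 hWs
  have hT2 : s ≤ 2 * W * T := by
    have : s < W * (T + 1) := Nat.lt_mul_div_succ s (by omega)
    nlinarith
  have hTs : T ≤ s := Nat.div_le_self _ _
  have hdiv : E * T / E = T := Nat.mul_div_cancel_left _ hE
  -- If every slice were thick, `exists_growth` would give `z` more mass than `hsk` allows.
  obtain ⟨r, hr, hr1, hr2⟩ : ∃ r < E * T,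
      K * chainMass (bdry (ballPart p.1 (2 * r) z)) ≤ (r / E) ^ k ∧
      2 * (r / E) * chainMass (bdry (ballPart p.1 (2 * r) z)) ≤
        chainMass (ballPart p.1 (2 * r) z) := by
    by_contra! hbad
    have h1 := hgrow (fun r => chainMass (ballPart p.1 (2 * r) z))
      (fun r => chainMass (bdry (ballPart p.1 (2 * r) z))) (E * T) (one_le_chainMass (hpos _))
      (fun r _ => chainMass_bdry_ballPart_le hz fun c hc => absurd (by rw [hb]; rfl) hc)
      (fun r hr => by
        by_cases h : (r / E) ^ k < K * chainMass (bdry (ballPart p.1 (2 * r) z))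
        · exact Or.inl h
        · exact Or.inr (hbad r hr (not_lt.1 h)))
    rw [hdiv] at h1
    have h2 := h1.trans (Nat.mul_le_mul_left M (chainMass_ballPart_le p.1 _ z))
    have h3 : s ^ (k + 1) ≤ M * (2 * W) ^ (k + 1) * chainMass z := by
      calc s ^ (k + 1) ≤ (2 * W * T) ^ (k + 1) := Nat.pow_le_pow_left hT2 _
        _ = (2 * W) ^ (k + 1) * T ^ (k + 1) := mul_pow _ _ _
        _ ≤ (2 * W) ^ (k + 1) * (M * chainMass z) := Nat.mul_le_mul_left _ h2
        _ = _ := by ring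
    rw [add_one_mul] at hsk
    omega
  set u := ballPart p.1 (2 * r) z
  have hτ : r / E ≤ T := (Nat.div_le_div_right hr.le).trans hdiv.le
  have hu : IsPure (k + 1) u := hz.ballPart _ _
  obtain ⟨y, hy1, hy2, hy3, hy4⟩ := hK D L (bdry u) (r / E) (by omega) hu.bdry (bdry_bdry u) hr1
  have hyu : 2 * chainMass y ≤ chainMass u := by
    rw [mul_assoc] at hr2
    exact (Nat.mul_le_mul_left 2 hy3).trans hr2
  have hWT : W * T = 8 * (E * T) + 8 * T := by rw [hW]; ring
  have hcyc : bdry (u + y) = 0 := by rw [map_add, hy1, chain_add_self]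
  obtain ⟨w₁, h1, h2, h3⟩ := exists_cone (p := p.1) (r := 2 * (E * T) + T)
    (by omega) (hu.add hy2) (fun c hc => by
      obtain hc | hc := Finset.mem_union.1 (chainSupp_add_subset _ _ (mem_chainSupp.2 hc))
      · have := (ballPart_ne_zero.1 (mem_chainSupp.1 hc)).1
        omega
      · obtain ⟨c', g1, g2⟩ := hy4 c (mem_chainSupp.1 hc)
        have g3 := torusDist_le_of_bdry_ballPart g1
        have g4 := torusDist_triangle p.1 c'.1 c.1
        rw [torusDist_comm] at g2
        omega) hcyc
  have h4 := chainMass_add_le u y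
  have h5 := chainMass_add_le (z + u) y
  have h6 : chainMass (z + u) + chainMass u = _ := chainMass_add_ballPart p.1 (2 * r) z
  have h7 : 1 ≤ chainMass u := one_le_chainMass (hpos _)
  obtain ⟨w₂, g1, g2, g3⟩ := ih _ (by omega) (z + u + y) ((hz.add hu).add hy2)
    (by rw [add_assoc, map_add, hb, hcyc, add_zero])
    ((Nat.mul_le_mul_left _ (by omega)).trans hsk) rfl
  refine ⟨w₁ + w₂, ?_, h2.add g2, ?_⟩
  · rw [map_add, h1, g1, add_assoc z, add_left_comm, chain_add_self, add_zero]
  · have e1 := chainMass_add_le w₁ w₂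
    have e2 : 2 * chainMass w₁ ≤ s * chainMass u := by
      calc 2 * chainMass w₁ ≤ 2 * ((2 * (E * T) + T) * chainMass (u + y)) :=
            Nat.mul_le_mul_left _ h3
        _ = (2 * (E * T) + T) * (2 * chainMass (u + y)) := by ring
        _ ≤ (2 * (E * T) + T) * (3 * chainMass u) := Nat.mul_le_mul_left _ (by omega)
        _ = (3 * (2 * (E * T) + T)) * chainMass u := by ring
        _ ≤ s * chainMass u := Nat.mul_le_mul_right _ (by omega)
    have e3 : s * (2 * chainMass (z + u + y)) + s * chainMass u ≤ s * (2 * chainMass z) := by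
      rw [← mul_add]
      exact Nat.mul_le_mul_left _ (by omega)
    have e4 : s * (2 * chainMass (z + u + y)) = 2 * (s * chainMass (z + u + y)) := by ring
    have e5 : s * (2 * chainMass z) = 2 * (s * chainMass z) := by ring
    omega

theorem exists_fillingMassBound (k : ℕ) : ∃ K, FillingMassBound k K := by
  induction k with
  | zero => exact ⟨2, fillingMassBound_zero⟩
  | succ k ih =>
    obtain ⟨K, hK⟩ := ih
    obtain ⟨K', hK'⟩ := hK.fillingBound
    exact hK'.fillingMassBound_succ

/-- Every chain of small mass can be replaced by one with the same boundary that stays close to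
the boundary. The constant does not depend on the dimension of the torus. -/
theorem exists_filling_near_bdry (k : ℕ) : ∃ A : ℕ, 0 < A ∧ ∀ (D L : ℕ) [NeZero L]
    (x : CubeChain D L) (T : ℕ), IsPure (k + 1) x → T ≤ L → A * chainMass x < T ^ (k + 1) →
    ∃ x' : CubeChain D L, bdry x' = bdry x ∧ IsPure (k + 1) x' ∧
      ∀ c, x' c ≠ 0 → ∃ c', bdry x c' ≠ 0 ∧ torusDist c'.1 c.1 ≤ A * T := by
  obtain ⟨K, hK⟩ := exists_fillingMassBound k
  obtain ⟨E, M, hE, hM, hmon⟩ := exists_monotonicity hK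
  -- `2 * E` converts the distance `A * T` into the monotonicity radius `E * T`, and `M` makes the
  -- mass bound strict.
  refine ⟨2 * E + M, by omega, ?_⟩
  intro D L _ x T hx hT hxT
  obtain ⟨x', h1, h2, h3⟩ := exists_isMinimalFilling hx
  refine ⟨x', h2, h1.1, fun c hc => ?_⟩
  by_contra! hfar
  have hdiv : E * T / E = T := Nat.mul_div_cancel_left _ hE
  have h4 := hmon D L x' c (E * T) h1 hc (fun c' hc' => by
    have := hfar c' (h2 ▸ hc')
    rw [torusDist_comm]
    nlinarith) (by rw [hdiv]; exact hT)
  rw [hdiv] at h4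
  have h5 := h4.trans (Nat.mul_le_mul_left M h3)
  rw [add_mul] at hxT
  have : 0 ≤ 2 * E * chainMass x := Nat.zero_le _
  omega

/-! ### Components and balls in graphs -/

section Graphs

variable {V : Type*} {G : SimpleGraph V} {A : Set V}

theorem SetComponent.mem_verts {K : SetComponent G A} {v : V} :
    v ∈ K.verts ↔ ∃ h : v ∈ A, (G.induce A).connectedComponentMk ⟨v, h⟩ = K := by
  simp [SetComponent.verts, SimpleGraph.ConnectedComponent.mem_supp_iff]

theorem SetComponent.verts_subset (K : SetComponent G A) : K.verts ⊆ A :=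
  fun _ hv => (SetComponent.mem_verts.1 hv).1

theorem SetComponent.mem_verts_of_adj {K : SetComponent G A} {u v : V} (hu : u ∈ K.verts)
    (h : G.Adj u v) (hv : v ∈ A) : v ∈ K.verts := by
  obtain ⟨hA, hK⟩ := SetComponent.mem_verts.1 hu
  refine SetComponent.mem_verts.2 ⟨hv, ?_⟩
  rw [← hK]
  exact SimpleGraph.ConnectedComponent.sound
    (SimpleGraph.Adj.reachable (G := G.induce A) (u := ⟨v, hv⟩) (v := ⟨u, hA⟩) h.symm)

theorem SetComponent.eq_of_mem_verts {K K' : SetComponent G A} {v : V} (h : v ∈ K.verts)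
    (h' : v ∈ K'.verts) : K = K' := by
  obtain ⟨hA, hK⟩ := SetComponent.mem_verts.1 h
  obtain ⟨hA', hK'⟩ := SetComponent.mem_verts.1 h'
  rw [← hK, ← hK']

theorem SetComponent.exists_mem_verts {v : V} (h : v ∈ A) : ∃ K : SetComponent G A, v ∈ K.verts :=
  ⟨_, SetComponent.mem_verts.2 ⟨h, rfl⟩⟩

theorem SetComponent.mem_graphInterior_verts {K : SetComponent G A} {u : V}
    (hu : u ∈ graphInterior G A) (hK : u ∈ K.verts) : u ∈ graphInterior G K.verts :=
  ⟨hK, fun v hv => K.mem_verts_of_adj hK hv (hu.2 v hv)⟩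

theorem iterate_ballOne_mono (G : SimpleGraph V) (A : Set V) :
    Monotone fun t => (ballOne G)^[t] A := by
  refine monotone_nat_of_le_succ fun t v hv => ?_
  rw [Function.iterate_succ_apply']
  exact Or.inl hv

theorem mem_iterate_ballOne_succ {t : ℕ} {u v : V} (hu : u ∈ (ballOne G)^[t] A) (h : G.Adj u v) :
    v ∈ (ballOne G)^[t + 1] A := by
  rw [Function.iterate_succ_apply']
  exact Or.inr ⟨u, hu, h⟩

end Graphs

/-! ### The Union-Find decoder -/

namespace CSSCode

theorem errorVec_symmDiff {Q : Type*} [DecidableEq Q] (x y : Finset Q) : errorVec (x ∆ y) = errorVec x + errorVec y := by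
  ext q
  simp only [errorVec, Finset.mem_symmDiff, Pi.add_apply]
  by_cases h1 : q ∈ x <;> by_cases h2 : q ∈ y <;> simp [h1, h2, CharTwo.add_self_eq_zero]

variable {RX RZ Q : Type*} [Fintype Q]

theorem tannerGraph_adj_inl_inr (S : CSSCode RX RZ Q) {q : Q} {c : RZ} :
    S.tannerGraph.Adj (Sum.inl q) (Sum.inr c) ↔ S.HZ c q ≠ 0 := by
  simp [tannerGraph]

variable [DecidableEq Q] (S : CSSCode RX RZ Q)

theorem mulVec_errorVec_congr {x y : Finset Q} {c : RZ}
    (h : ∀ q, S.tannerGraph.Adj (Sum.inl q) (Sum.inr c) → (q ∈ x ↔ q ∈ y)) :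
    (S.HZ *ᵥ errorVec x) c = (S.HZ *ᵥ errorVec y) c := by
  refine Finset.sum_congr rfl fun q _ => ?_
  by_cases hq : S.HZ c q = 0
  · simp [hq]
  · simp [errorVec, h q (S.tannerGraph_adj_inl_inr.2 hq)]

theorem mulVec_errorVec_eq_zero {x : Finset Q} {c : RZ}
    (h : ∀ q, S.tannerGraph.Adj (Sum.inl q) (Sum.inr c) → q ∉ x) :
    (S.HZ *ᵥ errorVec x) c = 0 := by
  rw [S.mulVec_errorVec_congr (y := ∅) fun q hq => by simp [h q hq]]
  have : errorVec (∅ : Finset Q) = 0 := by ext q; simp [errorVec]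
  rw [this, Matrix.mulVec_zero, Pi.zero_apply]

theorem mulVec_errorVec_symmDiff {x y : Finset Q} (h : S.syndrome x = S.syndrome y) :
    S.HZ *ᵥ errorVec (x ∆ y) = 0 := by
  rw [errorVec_symmDiff, Matrix.mulVec_add]
  ext c
  have hc : (S.HZ *ᵥ errorVec x) c ≠ 0 ↔ (S.HZ *ᵥ errorVec y) c ≠ 0 := Set.ext_iff.1 h c
  rw [Pi.add_apply, Pi.zero_apply]
  generalize (S.HZ *ᵥ errorVec x) c = a at hc
  generalize (S.HZ *ᵥ errorVec y) c = b at hc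
  revert a b
  decide

/-- The restriction of `x` to a component is a valid correction there: a check inside the component
sees no other qubits of `x`, and a check outside it sees none of the restriction. -/
theorem allComponentsValid_of_subset_interior {σ : Set RZ} {E : Set (Q ⊕ RZ)} {x : Finset Q}
    (hσ : S.syndrome x = σ) (hx : ∀ q ∈ x, Sum.inl q ∈ graphInterior S.tannerGraph E) :
    S.AllComponentsValid σ E := by
  classical
  intro K
  refine ⟨x.filter fun q => Sum.inl q ∈ K.verts, fun q hq => ?_, ?_⟩
  · rw [Finset.mem_filter] at hq
    exact SetComponent.mem_graphInterior_verts (hx q hq.1) hq.2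
  · ext c
    by_cases hc : Sum.inr c ∈ K.verts
    · have : (S.HZ *ᵥ errorVec (x.filter fun q => Sum.inl q ∈ K.verts)) c =
          (S.HZ *ᵥ errorVec x) c := by
        refine S.mulVec_errorVec_congr fun q hq => ?_
        rw [Finset.mem_filter, and_iff_left_iff_imp]
        exact fun h => K.mem_verts_of_adj hc hq.symm (hx q h).1
      simp only [← hσ, syndrome, Set.mem_ofPred_eq, this, hc, and_true]
    · have : (S.HZ *ᵥ errorVec (x.filter fun q => Sum.inl q ∈ K.verts)) c = 0 := by
        refine S.mulVec_errorVec_eq_zero fun q hq h => hc ?_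
        rw [Finset.mem_filter] at h
        exact K.mem_verts_of_adj h.2 hq ((hx q h.1).2 _ hq)
      simp [syndrome, this, hc]

theorem syndrome_eq_of_valid_corrections {σ : Set RZ} {E : Set (Q ⊕ RZ)} {y : Finset Q}
    (hσ : Sum.inr '' σ ⊆ E) {z : SetComponent S.tannerGraph E → Finset Q}
    (hz : ∀ K, S.IsValidCorrection σ K.verts (z K)) (hy : ∀ q, q ∈ y ↔ ∃ K, q ∈ z K) :
    S.syndrome y = σ := by
  ext c
  by_cases hc : Sum.inr c ∈ E
  · obtain ⟨K, hK⟩ := SetComponent.exists_mem_verts (G := S.tannerGraph) hc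
    have h1 : (S.HZ *ᵥ errorVec y) c = (S.HZ *ᵥ errorVec (z K)) c := by
      refine S.mulVec_errorVec_congr fun q hq => ?_
      rw [hy]
      refine ⟨fun ⟨K', h⟩ => ?_, fun h => ⟨K, h⟩⟩
      rwa [SetComponent.eq_of_mem_verts hK (((hz K').1 q h).2 _ hq)]
    have h2 := Set.ext_iff.1 (hz K).2 c
    simp only [syndrome, Set.mem_ofPred_eq, hK, and_true] at h2
    simp only [syndrome, Set.mem_ofPred_eq, h1, h2]
  · have h1 : (S.HZ *ᵥ errorVec y) c = 0 := by
      refine S.mulVec_errorVec_eq_zero fun q hq h => hc ?_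
      obtain ⟨K, hK⟩ := (hy q).1 h
      exact K.verts_subset (((hz K).1 q hK).2 _ hq)
    have h2 : c ∉ σ := fun h => hc (hσ ⟨c, h, rfl⟩)
    simp [syndrome, h1, h2]

theorem exists_growthLoop {σ : Set RZ} {A : Set (Q ⊕ RZ)} {t : ℕ}
    (ht : S.AllComponentsValid σ ((ballOne S.tannerGraph)^[t] A)) :
    ∃ F, S.GrowthLoop σ A F ∧ S.AllComponentsValid σ F := by
  induction t generalizing A with
  | zero => exact ⟨A, .halt A ht, ht⟩
  | succ t ih =>
    by_cases hA : S.AllComponentsValid σ A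
    · exact ⟨A, .halt A hA, hA⟩
    · obtain ⟨F, hF, hval⟩ := ih ht
      exact ⟨F, .grow A F hA hF, hval⟩

/-- The loop is deterministic and halts at the first iterate with all components valid, so any such
iterate bounds the number of rounds. -/
theorem GrowthLoop.exists_iterate_eq {S : CSSCode RX RZ Q} {σ : Set RZ} {A F : Set (Q ⊕ RZ)}
    (hF : S.GrowthLoop σ A F) {t : ℕ}
    (ht : S.AllComponentsValid σ ((ballOne S.tannerGraph)^[t] A)) :
    ∃ s ≤ t, F = (ballOne S.tannerGraph)^[s] A := by
  induction hF generalizing t with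
  | halt E h => exact ⟨0, Nat.zero_le _, rfl⟩
  | grow E F h hF ih =>
    cases t with
    | zero => exact absurd ht h
    | succ t =>
      obtain ⟨s, hs, rfl⟩ := ih ht
      exact ⟨s + 1, by omega, rfl⟩

/-- The decoder succeeds on `x` if some error `x'` with the same syndrome lies in the interior of
the ball of radius `t` about the syndrome, and the undetectable errors in the union of `x` with
this ball are stabilizers. -/
theorem unionFindCorrects_of_ball {x x' : Finset Q} (t : ℕ) (hσ : S.syndrome x' = S.syndrome x)
    (hx' : ∀ q ∈ x', Sum.inl q ∈ graphInterior S.tannerGraph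
      ((ballOne S.tannerGraph)^[t] (Sum.inr '' S.syndrome x)))
    (hstab : ∀ y : Finset Q, S.HZ *ᵥ errorVec y = 0 →
      (∀ q ∈ y, q ∈ x ∨ Sum.inl q ∈ (ballOne S.tannerGraph)^[t] (Sum.inr '' S.syndrome x)) →
      S.IsStabilizer y) :
    S.UnionFindCorrects x := by
  classical
  have ht := S.allComponentsValid_of_subset_interior hσ hx'
  constructor
  · obtain ⟨F, hF, hval⟩ := S.exists_growthLoop ht
    choose z hz using hval
    refine ⟨Finset.univ.filter fun q => ∃ K, q ∈ z K, F, hF, z, hz, fun q => by simp⟩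
  · rintro y ⟨F, hF, z, hz, hy⟩
    obtain ⟨s, hs, rfl⟩ := hF.exists_iterate_eq ht
    have hsub := iterate_ballOne_mono S.tannerGraph (Sum.inr '' S.syndrome x) (Nat.zero_le s)
    have hsyn := S.syndrome_eq_of_valid_corrections hsub hz hy
    refine hstab _ (S.mulVec_errorVec_symmDiff hsyn.symm) fun q hq => ?_
    rw [Finset.mem_symmDiff] at hq
    obtain hq | hq := hq
    · exact Or.inl hq.1
    · obtain ⟨K, hK⟩ := (hy q).1 hq.1
      exact Or.inr (iterate_ballOne_mono _ _ hs (K.verts_subset ((hz K).1 q hK).1))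

end CSSCode

/-! ### The boundary matrices of the torus -/

/-- The chain with the given coefficients on the `k`-cells. -/
def toChain {D L k : ℕ} (v : TorusCell D L k → ZMod 2) : CubeChain D L :=
  fun c => if h : c.2.card = k then v ⟨c, h⟩ else 0

section Matrices

variable {D L : ℕ}

theorem isPure_toChain {k : ℕ} (v : TorusCell D L k → ZMod 2) : IsPure k (toChain v) := by
  intro c hc
  by_contra h
  exact hc (dif_neg h)

theorem toChain_apply {k : ℕ} (v : TorusCell D L k → ZMod 2) (c : TorusCell D L k) :
    toChain v c.1 = v c := dif_pos c.2

theorem toChain_restrict {k : ℕ} {z : CubeChain D L} (hz : IsPure k z) :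
    toChain (fun c : TorusCell D L k => z c.1) = z := by
  ext c
  by_cases h : c.2.card = k
  · exact dif_pos h
  · rw [toChain, dif_neg h]
    by_contra h'
    exact h (hz c (Ne.symm h'))

theorem mem_cellFaces {c f : CubeCell D L} :
    f ∈ cellFaces c ↔ ∃ l ∈ c.2, ∃ s, torusFace c l s = f := by
  rw [cellFaces, Finset.mem_image]
  constructor
  · rintro ⟨x, hx, rfl⟩
    exact ⟨x.1, (Finset.mem_product.1 hx).1, x.2, rfl⟩
  · rintro ⟨l, hl, s, rfl⟩
    exact ⟨(l, s), Finset.mem_product.2 ⟨hl, Finset.mem_univ _⟩, rfl⟩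

theorem mem_cellFaces_of_torusBoundary_ne_zero {k l : ℕ} {f : TorusCell D L k}
    {c : TorusCell D L l} (h : torusBoundary D L k l f c ≠ 0) : f.1 ∈ cellFaces c.1 := by
  obtain ⟨j, hj, h⟩ := Finset.exists_ne_zero_of_sum_ne_zero h
  obtain ⟨s, -, h⟩ := Finset.exists_ne_zero_of_sum_ne_zero h
  refine mem_cellFaces.2 ⟨j, hj, s, ?_⟩
  by_contra h'
  exact h (if_neg (Ne.symm h'))

/-- For `L = 1` opposite faces coincide and cancel mod 2, leaving a Tanner graph without edges;
hence `2 ≤ L`. -/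
theorem torusFace_injective (hL : 2 ≤ L) {c : CubeCell D L} {j j' : Fin D} {s s' : Fin 2}
    (hj : j ∈ c.2) (h : torusFace c j s = torusFace c j' s') : j = j' ∧ s = s' := by
  have : Fact (1 < L) := ⟨hL⟩
  obtain ⟨h1, h2⟩ := Prod.ext_iff.1 h
  have hjj : j = j' := by
    by_contra hne
    have : j ∈ c.2.erase j' := Finset.mem_erase.2 ⟨hne, hj⟩
    rw [show c.2.erase j' = c.2.erase j from h2.symm] at this
    exact Finset.notMem_erase _ _ this
  subst hjj
  refine ⟨rfl, ?_⟩
  have h3 := congrFun (add_left_cancel h1) j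
  revert h3
  fin_cases s <;> fin_cases s' <;> simp

theorem torusBoundary_ne_zero (hL : 2 ≤ L) {k l : ℕ} {f : TorusCell D L k}
    {c : TorusCell D L l} (h : f.1 ∈ cellFaces c.1) : torusBoundary D L k l f c ≠ 0 := by
  obtain ⟨j, hj, s, hf⟩ := mem_cellFaces.1 h
  rw [torusBoundary, Finset.sum_eq_single j, Finset.sum_eq_single s]
  · simp [hf]
  · intro s' _ hs'
    rw [if_neg]
    intro h'
    exact hs' (torusFace_injective hL hj (hf.trans h')).2.symm
  · intro h'
    exact absurd (Finset.mem_univ _) h'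
  · intro j' _ hj'
    refine Finset.sum_eq_zero fun s' _ => if_neg fun h' => ?_
    exact hj' (torusFace_injective hL hj (hf.trans h')).1.symm
  · intro h'
    exact absurd hj h'

variable [NeZero L]

theorem bdry_toChain {k l : ℕ} (hl : k + 1 = l) (v : TorusCell D L l → ZMod 2)
    (f : TorusCell D L k) : bdry (toChain v) f.1 = (torusBoundary D L k l *ᵥ v) f := by
  -- The direction `j`, the side `s` and the face `f` determine the cell, so each inner sum has at
  -- most one term.
  have hface : ∀ (j : Fin D) (s : Fin 2),
      ∑ c : TorusCell D L l, (if j ∈ c.1.2 ∧ f.1 = torusFace c.1 j s then v c else 0) =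
        if j ∈ f.1.2 then 0 else
          toChain v (f.1.1 - (if s = 1 then Pi.single j 1 else 0), insert j f.1.2) := by
    intro j s
    by_cases hj : j ∈ f.1.2
    · rw [if_pos hj]
      refine Finset.sum_eq_zero fun c _ => if_neg fun h => ?_
      rw [h.2] at hj
      exact Finset.notMem_erase _ _ hj
    · rw [if_neg hj]
      have hc : (insert j f.1.2).card = l := by rw [Finset.card_insert_of_notMem hj, f.2, hl]
      refine Eq.trans ?_ (toChain_apply v
        ⟨(f.1.1 - (if s = 1 then Pi.single j 1 else 0), insert j f.1.2), hc⟩).symm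
      refine (Finset.sum_eq_single _ (fun c _ hne => ?_) fun h => ?_).trans (if_pos ?_)
      · refine if_neg fun h => hne (Subtype.ext ?_)
        have h1 : f.1.1 = c.1.1 + _ := congrArg Prod.fst h.2
        have h2 : f.1.2 = c.1.2.erase j := congrArg Prod.snd h.2
        refine Prod.ext ?_ ?_
        · simp only [h1, add_sub_cancel_right]
        · simp only [h2, Finset.insert_erase h.1]
      · exact absurd (Finset.mem_univ _) h
      · refine ⟨Finset.mem_insert_self _ _, ?_⟩
        simp only [torusFace, Finset.erase_insert hj, sub_add_cancel]
  have hR : (torusBoundary D L k l *ᵥ v) f = ∑ j, ∑ s : Fin 2, ∑ c : TorusCell D L l,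
      (if j ∈ c.1.2 ∧ f.1 = torusFace c.1 j s then v c else 0) := by
    have : ∀ c : TorusCell D L l, torusBoundary D L k l f c * v c = ∑ j, ∑ s : Fin 2,
        (if j ∈ c.1.2 ∧ f.1 = torusFace c.1 j s then v c else 0) := by
      intro c
      rw [torusBoundary, Finset.sum_mul, ← Finset.sum_filter_of_ne (p := fun j => j ∈ c.1.2)
        (s := Finset.univ)]
      · rw [Finset.filter_mem_eq_inter, Finset.univ_inter]
        refine Finset.sum_congr rfl fun j hj => ?_
        rw [Finset.sum_mul]
        exact Finset.sum_congr rfl fun s _ => by simp [hj]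
      · intro j _ h
        by_contra hj
        simp [hj] at h
    simp only [Matrix.mulVec, dotProduct, this]
    rw [Finset.sum_comm]
    exact Finset.sum_congr rfl fun j _ => Finset.sum_comm
  rw [hR, bdry_apply_apply]
  refine Finset.sum_congr rfl fun j _ => ?_
  simp only [hface, Fin.sum_univ_two, bdryDir_apply]
  split_ifs <;> simp_all

end Matrices

/-! ### Balls of the Tanner graph of a toric code -/

/-- The set `A` of nodes of the Tanner graph contains the cell `c` as a check. -/
def ContainsCheck {D L k : ℕ} (A : Set (TorusCell D L (k + 1) ⊕ TorusCell D L (k + 1 - 1)))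
    (c : CubeCell D L) : Prop :=
  ∃ h : c.2.card = k, Sum.inr ⟨c, h⟩ ∈ A

/-- The set `A` of nodes of the Tanner graph contains the cell `c` as a qubit. -/
def ContainsQubit {D L k : ℕ} (A : Set (TorusCell D L (k + 1) ⊕ TorusCell D L (k + 1 - 1)))
    (c : CubeCell D L) : Prop :=
  ∃ h : c.2.card = k + 1, Sum.inl ⟨c, h⟩ ∈ A

/-- The cell that underlies a node of the Tanner graph. -/
def tannerCell {D L k : ℕ} (u : TorusCell D L (k + 1) ⊕ TorusCell D L (k + 1 - 1)) :
    CubeCell D L :=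
  Sum.elim Subtype.val Subtype.val u

section Tanner

variable {D L k : ℕ} [NeZero L]

theorem mem_cellFaces_of_tannerGraph_adj {q : TorusCell D L (k + 1)}
    {f : TorusCell D L (k + 1 - 1)}
    (h : (toricCode D L (k + 1)).tannerGraph.Adj (Sum.inl q) (Sum.inr f)) :
    f.1 ∈ cellFaces q.1 :=
  mem_cellFaces_of_torusBoundary_ne_zero
    ((toricCode D L (k + 1)).tannerGraph_adj_inl_inr.1 h)

theorem torusDist_le_one_of_tannerGraph_adj
    {u v : TorusCell D L (k + 1) ⊕ TorusCell D L (k + 1 - 1)}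
    (h : (toricCode D L (k + 1)).tannerGraph.Adj u v) :
    torusDist (tannerCell u).1 (tannerCell v).1 ≤ 1 := by
  obtain q | f := u <;> obtain q' | f' := v
  · simp [CSSCode.tannerGraph] at h
  · exact torusDist_le_one_of_mem_cellFaces (mem_cellFaces_of_tannerGraph_adj h)
  · rw [torusDist_comm]
    exact torusDist_le_one_of_mem_cellFaces (mem_cellFaces_of_tannerGraph_adj h.symm)
  · simp [CSSCode.tannerGraph] at h

theorem exists_torusDist_le_of_mem_iterate_ballOne
    {A : Set (TorusCell D L (k + 1) ⊕ TorusCell D L (k + 1 - 1))} {t : ℕ}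
    {u : TorusCell D L (k + 1) ⊕ TorusCell D L (k + 1 - 1)}
    (h : u ∈ (ballOne (toricCode D L (k + 1)).tannerGraph)^[t] A) :
    ∃ v ∈ A, torusDist (tannerCell v).1 (tannerCell u).1 ≤ t := by
  induction t generalizing u with
  | zero => exact ⟨u, h, by rw [torusDist_self]⟩
  | succ t ih =>
    rw [Function.iterate_succ_apply'] at h
    obtain h | ⟨w, hw, hwu⟩ := h
    · obtain ⟨v, hv, hd⟩ := ih h
      exact ⟨v, hv, by omega⟩
    · obtain ⟨v, hv, hd⟩ := ih hw
      have h1 := torusDist_le_one_of_tannerGraph_adj hwu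
      have h2 := torusDist_triangle (tannerCell v).1 (tannerCell w).1 (tannerCell u).1
      exact ⟨v, hv, by omega⟩

variable {A : Set (TorusCell D L (k + 1) ⊕ TorusCell D L (k + 1 - 1))}

theorem ContainsCheck.mono {s t : ℕ} (hst : s ≤ t) {c : CubeCell D L}
    (h : ContainsCheck ((ballOne (toricCode D L (k + 1)).tannerGraph)^[s] A) c) :
    ContainsCheck ((ballOne (toricCode D L (k + 1)).tannerGraph)^[t] A) c :=
  ⟨h.1, iterate_ballOne_mono _ _ hst h.2⟩

theorem ContainsQubit.mono {s t : ℕ} (hst : s ≤ t) {c : CubeCell D L}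
    (h : ContainsQubit ((ballOne (toricCode D L (k + 1)).tannerGraph)^[s] A) c) :
    ContainsQubit ((ballOne (toricCode D L (k + 1)).tannerGraph)^[t] A) c :=
  ⟨h.1, iterate_ballOne_mono _ _ hst h.2⟩

theorem ContainsCheck.containsQubit (hL : 2 ≤ L) {t : ℕ} {f c : CubeCell D L}
    (h : ContainsCheck ((ballOne (toricCode D L (k + 1)).tannerGraph)^[t] A) f)
    (hc : c.2.card = k + 1) (hf : f ∈ cellFaces c) :
    ContainsQubit ((ballOne (toricCode D L (k + 1)).tannerGraph)^[t + 1] A) c := by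
  obtain ⟨h1, h2⟩ := h
  refine ⟨hc, mem_iterate_ballOne_succ h2 (SimpleGraph.Adj.symm ?_)⟩
  exact (CSSCode.tannerGraph_adj_inl_inr _).2 (torusBoundary_ne_zero hL hf)

theorem ContainsQubit.containsCheck (hL : 2 ≤ L) {t : ℕ} {f c : CubeCell D L}
    (h : ContainsQubit ((ballOne (toricCode D L (k + 1)).tannerGraph)^[t] A) c)
    (hf : f ∈ cellFaces c) :
    ContainsCheck ((ballOne (toricCode D L (k + 1)).tannerGraph)^[t + 1] A) f := by
  obtain ⟨h1, h2⟩ := h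
  have hk : f.2.card = k := by
    obtain ⟨l, hl, s, rfl⟩ := mem_cellFaces.1 hf
    rw [torusFace, Finset.card_erase_of_mem hl, h1, Nat.add_sub_cancel]
  refine ⟨hk, mem_iterate_ballOne_succ h2 ?_⟩
  exact (CSSCode.tannerGraph_adj_inl_inr _).2 (torusBoundary_ne_zero hL hf)

theorem ContainsCheck.step (hL : 2 ≤ L) {t : ℕ} {f f' c : CubeCell D L}
    (h : ContainsCheck ((ballOne (toricCode D L (k + 1)).tannerGraph)^[t] A) f)
    (hc : c.2.card = k + 1) (hf : f ∈ cellFaces c) (hf' : f' ∈ cellFaces c) :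
    ContainsCheck ((ballOne (toricCode D L (k + 1)).tannerGraph)^[t + 2] A) f' :=
  (h.containsQubit hL hc hf).containsCheck hL hf'

omit [NeZero L] in
theorem mk_erase_mem_cellFaces (q : Fin D → ZMod L) {J : Finset (Fin D)} {l : Fin D} (hl : l ∈ J) :
    (q, J.erase l) ∈ cellFaces (q, J) :=
  mem_cellFaces.2 ⟨l, hl, 0, by simp [torusFace]⟩

omit [NeZero L] in
theorem mk_add_erase_mem_cellFaces (q : Fin D → ZMod L) {J : Finset (Fin D)} {l : Fin D}
    (hl : l ∈ J) : (q + Pi.single l 1, J.erase l) ∈ cellFaces (q, J) :=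
  mem_cellFaces.2 ⟨l, hl, 1, by simp [torusFace]⟩

omit [NeZero L] in
theorem mk_mem_cellFaces_insert (q : Fin D → ZMod L) {I : Finset (Fin D)} {l : Fin D}
    (hl : l ∉ I) : (q, I) ∈ cellFaces (q, insert l I) := by
  have := mk_erase_mem_cellFaces q (Finset.mem_insert_self l I)
  rwa [Finset.erase_insert hl] at this

omit [NeZero L] in
theorem mk_add_mem_cellFaces_insert (q : Fin D → ZMod L) {I : Finset (Fin D)} {l : Fin D}
    (hl : l ∉ I) : (q + Pi.single l 1, I) ∈ cellFaces (q, insert l I) := by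
  have := mk_add_erase_mem_cellFaces q (Finset.mem_insert_self l I)
  rwa [Finset.erase_insert hl] at this

omit [NeZero L] in
theorem ContainsCheck.card_insert {c : CubeCell D L} (h : ContainsCheck A c) {l : Fin D}
    (hl : l ∉ c.2) : (insert l c.2).card = k + 1 := by
  rw [Finset.card_insert_of_notMem hl, h.1]

theorem ContainsCheck.swap (hL : 2 ≤ L) {t : ℕ} {q : Fin D → ZMod L} {I : Finset (Fin D)}
    (h : ContainsCheck ((ballOne (toricCode D L (k + 1)).tannerGraph)^[t] A) (q, I))
    {l m : Fin D} (hl : l ∈ I) (hm : m ∉ I) :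
    ContainsCheck ((ballOne (toricCode D L (k + 1)).tannerGraph)^[t + 2] A)
      (q, (insert m I).erase l) :=
  h.step hL (h.card_insert hm) (mk_mem_cellFaces_insert q hm)
    (mk_erase_mem_cellFaces q (Finset.mem_insert_of_mem hl))

omit [NeZero L] in
theorem ContainsCheck.exists_notMem (hD : k + 1 ≤ D) {c : CubeCell D L} (h : ContainsCheck A c) :
    ∃ m, m ∉ c.2 := by
  by_contra! h'
  have h1 := h.1
  rw [Finset.eq_univ_iff_forall.2 h', Finset.card_univ, Fintype.card_fin] at h1
  omega

theorem ContainsCheck.exists_add_single (hL : 2 ≤ L) (hD : k + 1 ≤ D) {t : ℕ}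
    {q : Fin D → ZMod L} {I : Finset (Fin D)}
    (h : ContainsCheck ((ballOne (toricCode D L (k + 1)).tannerGraph)^[t] A) (q, I))
    (l : Fin D) : ∃ I', ContainsCheck
      ((ballOne (toricCode D L (k + 1)).tannerGraph)^[t + 4] A) (q + Pi.single l 1, I') := by
  by_cases hl : l ∈ I
  · obtain ⟨m, hm⟩ := h.exists_notMem hD
    exact ⟨_, (h.step hL (h.card_insert hm) (mk_mem_cellFaces_insert q hm)
      (mk_add_erase_mem_cellFaces q (Finset.mem_insert_of_mem hl))).mono (by omega)⟩
  · exact ⟨_, (h.step hL (h.card_insert hl) (mk_mem_cellFaces_insert q hl)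
      (mk_add_mem_cellFaces_insert q hl)).mono (by omega)⟩

/-- A check orthogonal to `l` moves along `l` through one qubit, in two rounds. If `l ∈ I`, it is
first exchanged for a free direction `m`, which exists because `k < D`; this costs two more rounds.
-/
theorem ContainsCheck.exists_sub_single (hL : 2 ≤ L) (hD : k + 1 ≤ D) {t : ℕ}
    {q : Fin D → ZMod L} {I : Finset (Fin D)}
    (h : ContainsCheck ((ballOne (toricCode D L (k + 1)).tannerGraph)^[t] A) (q, I))
    (l : Fin D) : ∃ I', ContainsCheck
      ((ballOne (toricCode D L (k + 1)).tannerGraph)^[t + 4] A) (q - Pi.single l 1, I') := by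
  have key : ∀ {t : ℕ} {I : Finset (Fin D)}, l ∉ I →
      ContainsCheck ((ballOne (toricCode D L (k + 1)).tannerGraph)^[t] A) (q, I) →
      ContainsCheck ((ballOne (toricCode D L (k + 1)).tannerGraph)^[t + 2] A)
        (q - Pi.single l 1, I) := by
    intro t I hl h
    refine h.step hL (h.card_insert hl) ?_ (mk_mem_cellFaces_insert _ hl)
    have := mk_add_mem_cellFaces_insert (q - Pi.single l 1) hl
    rwa [sub_add_cancel] at this
  by_cases hl : l ∈ I
  · obtain ⟨m, hm⟩ := h.exists_notMem hD
    exact ⟨_, key (Finset.notMem_erase l _) (h.swap hL hl hm)⟩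
  · exact ⟨_, (key hl h).mono (by omega)⟩

theorem natAbs_circlePos_add_one_lt {a b : ZMod L} (h : 0 < circlePos a b) :
    (circlePos (a + 1) b).natAbs < (circlePos a b).natAbs := by
  have h1 := circlePos_bounds a b
  have h2 : circlePos (a + 1) b = circlePos a b - 1 := by
    rw [circlePos_eq_iff]
    refine ⟨?_, by constructor <;> omega⟩
    rw [Int.cast_sub, ← ((circlePos_eq_iff a b _).1 rfl).1]
    push_cast
    ring
  omega

theorem natAbs_circlePos_sub_one_lt {a b : ZMod L} (h : circlePos a b < 0) :
    (circlePos (a - 1) b).natAbs < (circlePos a b).natAbs := by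
  have h1 := circlePos_bounds a b
  have h2 : circlePos (a - 1) b = circlePos a b + 1 := by
    rw [circlePos_eq_iff]
    refine ⟨?_, by constructor <;> omega⟩
    rw [Int.cast_add, ← ((circlePos_eq_iff a b _).1 rfl).1]
    push_cast
    ring
  omega

omit [NeZero L] in
theorem torusDist_lt_of_coord {q q₁ q' : Fin D → ZMod L} (l : Fin D)
    (h : (circlePos (q₁ l) (q' l)).natAbs < (circlePos (q l) (q' l)).natAbs)
    (hne : ∀ j ≠ l, q₁ j = q j) : torusDist q₁ q' < torusDist q q' := by
  refine Finset.sum_lt_sum (fun j _ => ?_) ⟨l, Finset.mem_univ l, h⟩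
  by_cases hj : j = l
  · subst hj; exact h.le
  · rw [hne j hj]

theorem exists_circlePos_ne_zero {q q' : Fin D → ZMod L} (h : q ≠ q') :
    ∃ l, circlePos (q l) (q' l) ≠ 0 := by
  obtain ⟨l, hl⟩ := Function.ne_iff.1 h
  refine ⟨l, fun h0 => hl ?_⟩
  rw [← circlePos_self (q l)] at h0
  exact (circlePos_inj.1 h0).symm

/-- Unit moves towards `q'`, four rounds each; the directions of the check are left uncontrolled and
corrected afterwards. -/
theorem ContainsCheck.exists_of_torusDist_le (hL : 2 ≤ L) (hD : k + 1 ≤ D) {t n : ℕ}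
    {q q' : Fin D → ZMod L} {I : Finset (Fin D)}
    (h : ContainsCheck ((ballOne (toricCode D L (k + 1)).tannerGraph)^[t] A) (q, I))
    (hn : torusDist q q' ≤ n) : ∃ I', ContainsCheck
      ((ballOne (toricCode D L (k + 1)).tannerGraph)^[t + 4 * n] A) (q', I') := by
  by_cases hq : q = q'
  · subst hq
    exact ⟨I, h.mono (by omega)⟩
  obtain ⟨l, hl⟩ := exists_circlePos_ne_zero hq
  induction n generalizing t q I l with
  | zero =>
    have := natAbs_circlePos_le_torusDist q q' l
    omega
  | succ n ih =>
    obtain ⟨q₁, I₁, h₁, hd⟩ : ∃ q₁ I₁, ContainsCheck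
        ((ballOne (toricCode D L (k + 1)).tannerGraph)^[t + 4] A) (q₁, I₁) ∧
        torusDist q₁ q' < torusDist q q' := by
      obtain hl | hl := lt_or_gt_of_ne hl
      · obtain ⟨I₁, h₁⟩ := h.exists_sub_single hL hD l
        refine ⟨_, I₁, h₁, torusDist_lt_of_coord l ?_ fun j hj => by simp [hj]⟩
        simpa using natAbs_circlePos_sub_one_lt hl
      · obtain ⟨I₁, h₁⟩ := h.exists_add_single hL hD l
        refine ⟨_, I₁, h₁, torusDist_lt_of_coord l ?_ fun j hj => by simp [hj]⟩
        simpa using natAbs_circlePos_add_one_lt hl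
    by_cases hq₁ : q₁ = q'
    · subst hq₁
      exact ⟨I₁, h₁.mono (by omega)⟩
    · obtain ⟨l₁, hl₁⟩ := exists_circlePos_ne_zero hq₁
      obtain ⟨I', h'⟩ := ih h₁ (by omega) hq₁ l₁ hl₁
      exact ⟨I', h'.mono (by omega)⟩

/-- Each direction of `I` outside `J` is exchanged for one in `J` in two rounds; the last round
passes from a face of `(q, J)` to the qubit. -/
theorem ContainsCheck.containsQubit_of_base_eq (hL : 2 ≤ L) {t n : ℕ} {q : Fin D → ZMod L}
    {I J : Finset (Fin D)}
    (h : ContainsCheck ((ballOne (toricCode D L (k + 1)).tannerGraph)^[t] A) (q, I))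
    (hJ : J.card = k + 1) (hn : (I \ J).card = n) :
    ContainsQubit ((ballOne (toricCode D L (k + 1)).tannerGraph)^[t + 2 * n + 1] A) (q, J) := by
  have hIJ : (J \ I).card = n + 1 := by
    have h1 := Finset.card_sdiff_add_card_inter I J
    have h2 := Finset.card_sdiff_add_card_inter J I
    have h3 : I.card = k := h.1
    rw [Finset.inter_comm] at h2
    omega
  induction n generalizing t I with
  | zero =>
    have hsub : I ⊆ J := Finset.sdiff_eq_empty_iff_subset.1 (Finset.card_eq_zero.1 hn)
    obtain ⟨l, hl⟩ := Finset.card_eq_one.1 hIJ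
    have hl' : l ∈ J \ I := by rw [hl]; exact Finset.mem_singleton_self l
    rw [Finset.mem_sdiff] at hl'
    have hJ' : J = insert l I := by
      rw [← Finset.sdiff_union_of_subset hsub, hl]
      rfl
    refine h.containsQubit hL hJ ?_
    rw [hJ']
    exact mk_mem_cellFaces_insert q hl'.2
  | succ n ih =>
    obtain ⟨l, hl⟩ : (I \ J).Nonempty := Finset.card_pos.1 (by omega)
    obtain ⟨m, hm⟩ : (J \ I).Nonempty := Finset.card_pos.1 (by omega)
    rw [Finset.mem_sdiff] at hl hm
    have hlm : l ≠ m := fun h => hl.2 (h ▸ hm.1)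
    have e1 : (insert m I).erase l \ J = (I \ J).erase l := by
      ext j
      simp only [Finset.mem_sdiff, Finset.mem_erase, Finset.mem_insert]
      constructor
      · rintro ⟨⟨h1, rfl | h2⟩, h3⟩
        · exact absurd hm.1 h3
        · exact ⟨h1, h2, h3⟩
      · rintro ⟨h1, h2, h3⟩
        exact ⟨⟨h1, Or.inr h2⟩, h3⟩
    have e2 : J \ (insert m I).erase l = (J \ I).erase m := by
      ext j
      simp only [Finset.mem_sdiff, Finset.mem_erase, Finset.mem_insert]
      constructor
      · rintro ⟨h1, h2⟩
        have hjl : j ≠ l := fun h => hl.2 (h ▸ h1)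
        exact ⟨fun h => h2 ⟨hjl, Or.inl h⟩, h1, fun h => h2 ⟨hjl, Or.inr h⟩⟩
      · rintro ⟨h1, h2, h3⟩
        exact ⟨h2, fun h => h.2.elim h1 h3⟩
    refine (ih (h.swap hL hl.1 hm.2) ?_ ?_).mono (by omega)
    · rw [e1, Finset.card_erase_of_mem (Finset.mem_sdiff.2 hl), hn, Nat.add_sub_cancel]
    · rw [e2, Finset.card_erase_of_mem (Finset.mem_sdiff.2 hm), hIJ, Nat.add_sub_cancel]

/-- The rounds are `4 * d` for moving the base point, `2 * k` for exchanging directions, one to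
reach the qubit and one for its neighbors. -/
theorem mem_graphInterior_of_torusDist_le (hL : 2 ≤ L) (hD : k + 1 ≤ D) {d : ℕ}
    {f : CubeCell D L} (hf : ContainsCheck A f) {q : TorusCell D L (k + 1)}
    (hd : torusDist f.1 q.1.1 ≤ d) :
    Sum.inl q ∈ graphInterior (toricCode D L (k + 1)).tannerGraph
      ((ballOne (toricCode D L (k + 1)).tannerGraph)^[4 * d + 2 * k + 2] A) := by
  have hf0 : ContainsCheck ((ballOne (toricCode D L (k + 1)).tannerGraph)^[0] A) (f.1, f.2) := hf
  obtain ⟨I, hI⟩ := hf0.exists_of_torusDist_le hL hD hd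
  have h1 := hI.containsQubit_of_base_eq hL q.2 rfl
  have h2 : (I \ q.1.2).card ≤ k := (Finset.card_le_card Finset.sdiff_subset).trans hI.1.le
  obtain ⟨_, h3⟩ := h1.mono (show _ ≤ 4 * d + 2 * k + 1 by omega)
  exact ⟨iterate_ballOne_mono _ _ (Nat.le_succ _) h3, fun v hv => mem_iterate_ballOne_succ h3 hv⟩

end Tanner

/-! ### Projections of balls to the coordinate subtori -/

section Projection

variable {D L : ℕ} [NeZero L]

theorem card_circleBall_le (p : ZMod L) (t : ℕ) :
    (Finset.univ.filter fun v => (circlePos p v).natAbs ≤ t).card ≤ 2 * t + 1 := by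
  have := Finset.card_le_card_of_injOn (t := Finset.Icc (-(t : ℤ)) t) (circlePos p)
    (s := Finset.univ.filter fun v => (circlePos p v).natAbs ≤ t)
    (fun v hv => by
      have : (circlePos p v).natAbs ≤ t := (Finset.mem_filter.1 hv).2
      rw [Finset.mem_coe, Finset.mem_Icc]
      omega)
    (fun a _ b _ hab => circlePos_inj.1 hab)
  rw [Int.card_Icc] at this
  omega

/-- A set of cells and a union of balls that are too small to cover the coordinate subtorus in the
directions `I` miss one of its cells. -/
theorem exists_missed_cell (X Y : Finset (CubeCell D L)) (I : Finset (Fin D)) (t : ℕ)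
    (h : X.card + Y.card * (2 * t + 1) ^ I.card < L ^ I.card) :
    ∃ a : Fin D → ZMod L, ∀ q, (∀ j ∈ I, q j = a j) →
      (q, I) ∉ X ∧ ∀ f ∈ Y, t < torusDist f.1 q := by
  classical
  -- Only the coordinates in `I` matter: a ball projects into a box of side `2 * t + 1`, so the
  -- count does not involve `D`.
  set B : Finset (I → ZMod L) := X.image (fun c j => c.1 j) ∪
    Y.biUnion fun f => Fintype.piFinset fun j : I =>
      Finset.univ.filter fun v => (circlePos (f.1 j) v).natAbs ≤ t with hB
  have hcard : B.card < Fintype.card (I → ZMod L) := by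
    refine lt_of_le_of_lt ((Finset.card_union_le _ _).trans (Nat.add_le_add Finset.card_image_le
      (Finset.card_biUnion_le_card_mul _ _ ((2 * t + 1) ^ I.card) fun f _ => ?_))) ?_
    · rw [Fintype.card_piFinset]
      refine (Finset.prod_le_pow_card _ _ (2 * t + 1) fun j _ => card_circleBall_le _ _).trans ?_
      simp
    · simpa [ZMod.card] using h
  obtain ⟨a, -, ha⟩ := Finset.exists_mem_notMem_of_card_lt_card
    (s := B) (t := Finset.univ) (by rwa [Finset.card_univ])
  refine ⟨fun j => if hj : j ∈ I then a ⟨j, hj⟩ else 0, fun q hq => ?_⟩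
  have hqa : (fun j : I => q j) = a := by
    ext j
    exact (hq j j.2).trans (dif_pos j.2)
  rw [hB, Finset.mem_union, not_or, Finset.mem_biUnion] at ha
  refine ⟨fun hX => ha.1 (Finset.mem_image.2 ⟨_, hX, hqa⟩), fun f hf => ?_⟩
  by_contra! hd
  refine ha.2 ⟨f, hf, Fintype.mem_piFinset.2 fun j => ?_⟩
  rw [← hqa, Finset.mem_filter]
  exact ⟨Finset.mem_univ _, (natAbs_circlePos_le_torusDist f.1 q j).trans hd⟩

theorem chainMass_bdry_le {k : ℕ} {z : CubeChain D L} (hz : IsPure (k + 1) z) :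
    chainMass (bdry z) ≤ chainMass z * (2 * (k + 1)) := by
  have hsub : chainSupp (bdry z) ⊆ (chainSupp z).biUnion cellFaces := by
    intro f hf
    obtain ⟨c, h1, h2⟩ := exists_mem_cellFaces_of_bdry_ne_zero (mem_chainSupp.1 hf)
    exact Finset.mem_biUnion.2 ⟨c, mem_chainSupp.2 h1, h2⟩
  refine (Finset.card_le_card hsub).trans (Finset.card_biUnion_le_card_mul _ _ _ fun c hc => ?_)
  rw [← hz c (mem_chainSupp.1 hc)]
  exact card_cellFaces_le c

end Projection

/-! ### Toric codes -/

section ToricCode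

variable {D L k : ℕ} [NeZero L]

omit [NeZero L] in
theorem toChain_errorVec_ne_zero {x : Finset (TorusCell D L k)} {c : TorusCell D L k} :
    toChain (CSSCode.errorVec x) c.1 ≠ 0 ↔ c ∈ x := by
  rw [toChain_apply, CSSCode.errorVec]
  simp

theorem chainSupp_toChain_errorVec (x : Finset (TorusCell D L k)) :
    chainSupp (toChain (CSSCode.errorVec x)) = x.map (Function.Embedding.subtype _) := by
  ext c
  rw [mem_chainSupp, Finset.mem_map]
  constructor
  · intro h
    exact ⟨⟨c, isPure_toChain _ c h⟩, toChain_errorVec_ne_zero.1 h, rfl⟩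
  · rintro ⟨c, hc, rfl⟩
    exact toChain_errorVec_ne_zero.2 hc

theorem bdry_toChain_errorVec_apply (x : Finset (TorusCell D L (k + 1)))
    (f : TorusCell D L (k + 1 - 1)) : bdry (toChain (CSSCode.errorVec x)) f.1 =
      ((toricCode D L (k + 1)).HZ *ᵥ CSSCode.errorVec x) f :=
  bdry_toChain rfl _ f

theorem mem_syndrome_iff (x : Finset (TorusCell D L (k + 1))) (f : TorusCell D L (k + 1 - 1)) :
    f ∈ (toricCode D L (k + 1)).syndrome x ↔ bdry (toChain (CSSCode.errorVec x)) f.1 ≠ 0 := by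
  rw [bdry_toChain_errorVec_apply]
  rfl

theorem bdry_toChain_errorVec_eq_zero {x : Finset (TorusCell D L (k + 1))}
    (h : (toricCode D L (k + 1)).HZ *ᵥ CSSCode.errorVec x = 0) :
    bdry (toChain (CSSCode.errorVec x)) = 0 := by
  ext c
  by_contra hc
  have h1 := (isPure_toChain (CSSCode.errorVec x)).bdry c hc
  refine hc ((bdry_toChain_errorVec_apply x ⟨c, h1⟩).trans ?_)
  rw [h]
  rfl

theorem isStabilizer_of_bdry_eq {x : Finset (TorusCell D L (k + 1))} {w : CubeChain D L}
    (hw : IsPure (k + 2) w) (h : bdry w = toChain (CSSCode.errorVec x)) :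
    (toricCode D L (k + 1)).IsStabilizer x := by
  have h1 : CSSCode.errorVec x = ∑ c : TorusCell D L (k + 2),
      w c.1 • (toricCode D L (k + 1)).HX.row c := by
    ext q
    rw [← toChain_apply (CSSCode.errorVec x) q, ← h, ← toChain_restrict hw, bdry_toChain rfl,
      Finset.sum_apply]
    refine Finset.sum_congr rfl fun c _ => ?_
    rw [toChain_restrict hw, mul_comm]
    rfl
  rw [CSSCode.IsStabilizer, h1]
  exact Submodule.sum_mem _ fun c _ => Submodule.smul_mem _ _ (Submodule.subset_span ⟨c, rfl⟩)

/-- The decoder corrects `x` if the ball of radius `t` about the syndrome is large enough to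
contain a nearby error with the same syndrome and too small to cover a coordinate subtorus. -/
theorem toricCode_unionFindCorrects {d t : ℕ} (hD : k + 1 ≤ D) (ht : t = 4 * d + 2 * k + 2)
    {x : Finset (TorusCell D L (k + 1))} {z : CubeChain D L}
    (hz : bdry z = bdry (toChain (CSSCode.errorVec x))) (hk : IsPure (k + 1) z)
    (hd : ∀ c, z c ≠ 0 → ∃ c', bdry (toChain (CSSCode.errorVec x)) c' ≠ 0 ∧
      torusDist c'.1 c.1 ≤ d)
    (hcard : x.card + x.card * (2 * (k + 1)) * (2 * t + 1) ^ (k + 1) < L ^ (k + 1)) :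
    (toricCode D L (k + 1)).UnionFindCorrects x := by
  classical
  have hx' : toChain (CSSCode.errorVec (Finset.univ.filter
      fun q : TorusCell D L (k + 1) => z q.1 ≠ 0)) = z := by
    rw [← toChain_restrict hk]
    congr 1
    ext q
    rw [CSSCode.errorVec, toChain_restrict hk]
    simp only [Finset.mem_filter, Finset.mem_univ, true_and]
    generalize z q.1 = a
    revert a
    decide
  have hmass : chainMass (bdry (toChain (CSSCode.errorVec x))) ≤ x.card * (2 * (k + 1)) := by
    have := chainMass_bdry_le (isPure_toChain (CSSCode.errorVec x))
    rwa [chainMass, chainMass, chainSupp_toChain_errorVec, Finset.card_map] at this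
  refine CSSCode.unionFindCorrects_of_ball _ (x' := Finset.univ.filter
      fun q : TorusCell D L (k + 1) => z q.1 ≠ 0) t ?_ ?_ ?_
  · ext f
    rw [mem_syndrome_iff, mem_syndrome_iff, hx', hz]
  · intro q hq
    obtain ⟨f, hf, hfd⟩ := hd q.1 (Finset.mem_filter.1 hq).2
    -- For `L = 1`, `hcard` would force `x` to be empty, contrary to its nonzero boundary.
    have hL : 2 ≤ L := by
      by_contra! hL
      have h1 : L = 1 := by have := NeZero.ne L; omega
      have h2 : 1 ≤ chainMass (toChain (CSSCode.errorVec x)) := by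
        obtain ⟨c, hc, -⟩ := exists_mem_cellFaces_of_bdry_ne_zero hf
        exact one_le_chainMass hc
      rw [chainMass, chainSupp_toChain_errorVec, Finset.card_map] at h2
      have h3 : L ^ (k + 1) = 1 := by rw [h1, one_pow]
      omega
    subst ht
    have hfk : f.2.card = k := (isPure_toChain (CSSCode.errorVec x)).bdry f hf
    exact mem_graphInterior_of_torusDist_le
      (A := Sum.inr '' (toricCode D L (k + 1)).syndrome x) hL hD (f := f)
      ⟨hfk, ⟨f, hfk⟩, (mem_syndrome_iff x ⟨f, hfk⟩).2 hf, rfl⟩ hfd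
  · intro y hy hsub
    obtain ⟨w, hw, hwk⟩ := exists_bdry_eq_of_missed (isPure_toChain (CSSCode.errorVec y))
      (bdry_toChain_errorVec_eq_zero hy) (fun I hI => by
        obtain ⟨a, ha⟩ := exists_missed_cell (x.map (Function.Embedding.subtype _))
          (chainSupp (bdry (toChain (CSSCode.errorVec x)))) I t (by
            rw [hI, Finset.card_map]
            exact lt_of_le_of_lt (Nat.add_le_add_left (Nat.mul_le_mul_right _ hmass) _) hcard)
        refine ⟨a, fun q hq => ?_⟩
        by_contra hqy
        obtain ⟨h1, h2⟩ := ha q hq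
        obtain h | h := hsub ⟨(q, I), hI⟩ (toChain_errorVec_ne_zero.1 hqy)
        · exact h1 (Finset.mem_map.2 ⟨_, h, rfl⟩)
        · obtain ⟨v, ⟨f, hf, rfl⟩, hv⟩ := exists_torusDist_le_of_mem_iterate_ballOne h
          exact absurd hv (not_le.2 (h2 f.1 (mem_chainSupp.2 ((mem_syndrome_iff x f).1 hf)))))
    exact isStabilizer_of_bdry_eq hwk hw

/-- The least `T` with `A * n < T ^ (k + 1)` satisfies `T ^ (k + 1) = O(n + 1)`. Hence the `O(n)`
balls of radius `O(T)` cover `O(n ^ 2)` projected cells, which is where the square comes from. -/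
theorem exists_toricCode_bound (k : ℕ) : ∃ B : ℕ, ∀ (D L : ℕ) [NeZero L], k + 1 ≤ D →
    ∀ x : Finset (TorusCell D L (k + 1)), B * x.card ^ 2 < L ^ (k + 1) →
      (toricCode D L (k + 1)).UnionFindCorrects x := by
  obtain ⟨A, hA, hfill⟩ := exists_filling_near_bdry k
  set P := 2 ^ (k + 1) * A + 1 with hP
  -- With `t = 4 * (A * T) + 2 * k + 2` and `1 ≤ T`, one has `2 * t + 1 ≤ (8 * A + 4 * k + 5) * T`.
  set G := (8 * A + 4 * k + 5) ^ (k + 1) with hG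
  have hG1 : 1 ≤ G := Nat.one_le_pow _ _ (by omega)
  refine ⟨1 + 2 * (k + 1) * G * P, ?_⟩
  intro D L _ hD x hx
  set n := x.card
  obtain ⟨T, hT1, hAT, hTP⟩ : ∃ T, 1 ≤ T ∧ A * n < T ^ (k + 1) ∧
      T ^ (k + 1) ≤ 2 ^ (k + 1) * A * n + 1 := by
    have hex : ∃ T, A * n < T ^ (k + 1) :=
      ⟨A * n + 1, (Nat.lt_succ_self _).trans_le (Nat.le_self_pow (by omega) _)⟩
    classical
    have h1 := Nat.find_spec hex
    have h2 : Nat.find hex ≠ 0 := by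
      intro h0
      rw [h0, zero_pow (by omega)] at h1
      omega
    refine ⟨Nat.find hex, by omega, h1, ?_⟩
    have h3 := Nat.find_min hex (m := Nat.find hex - 1) (by omega)
    rw [not_lt] at h3
    obtain h4 | h4 : Nat.find hex = 1 ∨ 2 ≤ Nat.find hex := by omega
    · rw [h4, one_pow]
      omega
    · calc Nat.find hex ^ (k + 1) ≤ (2 * (Nat.find hex - 1)) ^ (k + 1) :=
            Nat.pow_le_pow_left (by omega) _
        _ = 2 ^ (k + 1) * (Nat.find hex - 1) ^ (k + 1) := mul_pow _ _ _
        _ ≤ 2 ^ (k + 1) * (A * n) := Nat.mul_le_mul_left _ h3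
        _ ≤ _ := by rw [mul_assoc]; omega
  have hTn : n * T ^ (k + 1) ≤ P * n ^ 2 := by
    obtain h | h := Nat.eq_zero_or_pos n
    · simp [h]
    · calc n * T ^ (k + 1) ≤ n * (2 ^ (k + 1) * A * n + 1) := Nat.mul_le_mul_left _ hTP
        _ ≤ n * (2 ^ (k + 1) * A * n + n) := by gcongr; exact h
        _ = P * n ^ 2 := by rw [hP]; ring
  have hTL : T ≤ L := by
    refine (Nat.pow_le_pow_iff_left (show k + 1 ≠ 0 by omega)).1 ?_
    obtain h | h := Nat.eq_zero_or_pos n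
    · rw [h] at hTP hx
      have : 0 < L ^ (k + 1) := by omega
      omega
    · refine le_trans ?_ hx.le
      have h1 : T ^ (k + 1) ≤ n * T ^ (k + 1) := Nat.le_mul_of_pos_left _ h
      have h2 : P * n ^ 2 ≤ 2 * (k + 1) * G * P * n ^ 2 := by
        rw [mul_assoc (2 * (k + 1) * G)]
        exact Nat.le_mul_of_pos_left _ (by positivity)
      rw [add_mul]
      omega
  have hmass : chainMass (toChain (CSSCode.errorVec x)) = n := by
    rw [chainMass, chainSupp_toChain_errorVec, Finset.card_map]
  obtain ⟨z, h1, h2, h3⟩ := hfill D L (toChain (CSSCode.errorVec x)) T (isPure_toChain _) hTL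
    (by rwa [hmass])
  refine toricCode_unionFindCorrects hD rfl h1 h2 h3 (lt_of_le_of_lt ?_ hx)
  have h4 : (2 * (4 * (A * T) + 2 * k + 2) + 1) ^ (k + 1) ≤ G * T ^ (k + 1) := by
    rw [hG, ← mul_pow]
    refine Nat.pow_le_pow_left ?_ _
    nlinarith
  have h5 : n ≤ n ^ 2 := Nat.le_self_pow (by omega) n
  calc n + n * (2 * (k + 1)) * (2 * (4 * (A * T) + 2 * k + 2) + 1) ^ (k + 1)
      ≤ n ^ 2 + n * (2 * (k + 1)) * (G * T ^ (k + 1)) := by gcongr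
    _ = n ^ 2 + 2 * (k + 1) * G * (n * T ^ (k + 1)) := by ring
    _ ≤ n ^ 2 + 2 * (k + 1) * G * (P * n ^ 2) := by gcongr
    _ = (1 + 2 * (k + 1) * G * P) * n ^ 2 := by ring

end ToricCode

theorem mainTheorem4 (i : ℕ) (hi : 1 ≤ i) :
    ∃ C : ℝ, 0 < C ∧ ∀ (D L : ℕ) [NeZero L], i + 1 ≤ D →
      ∀ x : Finset (TorusCell D L i), (x.card : ℝ) ≤ C * (L : ℝ) ^ ((i : ℝ) / 2) →
        (toricCode D L i).UnionFindCorrects x := by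
  obtain ⟨k, rfl⟩ : ∃ k, i = k + 1 := ⟨i - 1, by omega⟩
  obtain ⟨B, hB⟩ := exists_toricCode_bound k
  -- Squaring the weight bound requires `B * C ^ 2 < 1`, which holds for this `C` even when `B = 0`.
  refine ⟨1 / ((B : ℝ) + 1), by positivity, ?_⟩
  intro D L _ hD x hx
  refine hB D L (by omega) x ?_
  have hL : (0 : ℝ) < L := Nat.cast_pos.2 (Nat.pos_of_ne_zero (NeZero.ne L))
  have hpow : ((L : ℝ) ^ (((k + 1 : ℕ) : ℝ) / 2)) ^ 2 = (L : ℝ) ^ (k + 1) := by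
    rw [← Real.rpow_natCast, ← Real.rpow_mul hL.le, ← Real.rpow_natCast]
    congr 1
    push_cast
    ring
  have h1 : (x.card : ℝ) ^ 2 ≤ (1 / ((B : ℝ) + 1)) ^ 2 * (L : ℝ) ^ (k + 1) := by
    rw [← hpow, ← mul_pow]
    exact pow_le_pow_left₀ (Nat.cast_nonneg _) hx 2
  have h2 : (B : ℝ) * (1 / ((B : ℝ) + 1)) ^ 2 < 1 := by
    have : (0 : ℝ) ≤ B := Nat.cast_nonneg _
    rw [div_pow, one_pow, mul_one_div, div_lt_one (by positivity)]
    nlinarith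
  have h3 : (B : ℝ) * (x.card : ℝ) ^ 2 < (L : ℝ) ^ (k + 1) := by
    calc (B : ℝ) * (x.card : ℝ) ^ 2
        ≤ B * ((1 / ((B : ℝ) + 1)) ^ 2 * (L : ℝ) ^ (k + 1)) := by gcongr
      _ = (B * (1 / ((B : ℝ) + 1)) ^ 2) * (L : ℝ) ^ (k + 1) := by ring
      _ < 1 * (L : ℝ) ^ (k + 1) := by gcongr
      _ = _ := one_mul _
  exact_mod_cast h3
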